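/- **Setting.** Let $m\ge 1$ and let $d_1,\dots,d_m$, $r_1,\dots,r_m\ge 1$ be integers. Put $d^*=d_1\cdots d_m$, $d_k^-=\prod_{j\ne k}d_j$, $r^*=r_1\cdots r_m$, $\mathsf{DoF}_m=r^*+\sum_{k}d_kr_k$. For a tensor $\mathcal T\in\mathbb R^{d_1\times\cdots\times d_m}$, $\mathfrak M_k(\mathcal T)\in\mathbb R^{d_k\times d_k^-}$ is its mode-$k$ matricization, $\|\cdot\|_{\rm F}$ the Frobenius norm, $\|\cdot\|_\infty$ the entrywise maximum norm, and $\|A\|_{2,\infty}$ the largest Euclidean norm of a row of the matrix $A$. $\mathcal T$ has Tucker rank $\boldsymbol\rho$ if $\operatorname{rank}\mathfrak M_k(\mathcal T)=\rho_k$ for all $k$, and $\mathbb M_{\mathbf r}$ is the set of $\mathcal T$ with $\operatorname{rank}\mathfrak M_k(\mathcal T)\le r_k$ for all $k$. A Tucker decomposition of size $\boldsymbol\rho$ is $\mathcal T=\mathcal C\cdot[\![U_1,\dots,U_m]\!]:=\mathcal C\times_1U_1\times_2\cdots\times_mU_m$ with $\mathcal C\in\mathbb R^{\rho_1\times\cdots\times\rho_m}$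 and $U_k\in\mathbb R^{d_k\times\rho_k}$ with orthonormal columns. A tensor of Tucker rank $\boldsymbol\rho$ is $\mu$-incoherent if it has such a decomposition with $\|U_k\|_{2,\infty}\le(\mu\rho_k/d_k)^{1/2}$ for all $k$. The tangent space $\mathbb T$ at $\mathcal T=\mathcal C\cdot[\![U_1,\dots,U_m]\!]$ is the image of the differential of $(\mathcal C,U)\mapsto\mathcal C\cdot[\![U_1,\dots,U_m]\!]$, that is $$\mathbb T=\Big\{\mathcal D\cdot[\![U_1,\dots,U_m]\!]+\sum_k\mathcal C\cdot[\![U_1,\dots,V_k,\dots,U_m]\!]:\ \mathcal D,V_1,\dots,V_m\text{ arbitrary}\Big\};$$ it depends only on $\mathcal T$ if $\mathcal T$ has Tucker rank exactly $\boldsymbol\rho$, and then it is the tangent space at $\mathcal T$ of the manifold of tensors of Tucker rank $\boldsymbol\rho$. $\mathcal P_{\mathbb T}$ is the orthogonal projection onto $\mathbb T$. Let $\mathcal Y=\mathcal T^*+\Xi$, where $\mathcal T^*$ has Tucker rank $\mathbf r$ and is $\mu^*$-incoherent. For $\delta>0$ and an array $A$ let $\|A\|_{H_p}=\sum_\omega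 (A_\omega^2+\delta^2)^{1/2}$, and let $f(\mathcal T)=\|\mathcal T-\mathcal Y\|_{H_p}$. The entries of $\Xi$ are i.i.d. copies of a random variable $\xi$ with the following properties: for some $\varepsilon>0$, $\gamma:=(\mathbb E|\xi|^{2+\varepsilon})^{1/(2+\varepsilon)}<\infty$; $\xi$ has a density $h_\xi$ with $h_\xi(x)=h_\xi(-x)$ for all $x$; and for some $b_0>0$, $h_\xi(x)\ge b_0^{-1}$ for all $|x|\le C_{m,\mu^*,r^*}(6\gamma+\delta)$, where $C_{m,\mu^*,r^*}=72(5m+1)^2\,3^m\mu^{*m}r^*$. **Lemma (two-phase regularity of the pseudo-Huber loss).** There are absolute constants $c,c_2>0$ and a constant $c_1>0$ depending only on the order $m$ such that, with probability exceeding $$1-c\sum_{k=1}^m d_k(d_k^-)^{-1-\min\{1,\varepsilon\}}-\exp(-\mathsf{DoF}_m/2),$$ the following facts hold simultaneously (with the convention $0^{-1}\cdot 0=0$). (1) For all $\mathcal T\in\mathbb R^{d_1\times\cdots\times d_m}$, all $\mathcal G\in\partial f(\mathcal T)$, and $\mathbb T$ the tangent space at $\mathcal T$ given by any Tucker decomposition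 of $\mathcal T$ (of any size), $$\|\mathcal P_{\mathbb T}(\mathcal G)\|_{\rm F}\le (d^*)^{1/2},\qquad f(\mathcal T)-f(\mathcal T^*)\ge\|\mathcal T-\mathcal T^*\|_\infty^{-1}\|\mathcal T-\mathcal T^*\|_{\rm F}^2-6d^*\gamma-d^*\delta.$$ Furthermore, if $\mathcal T$ has Tucker rank $\boldsymbol\rho$ (for instance $\boldsymbol\rho=\mathbf r$) and is $\mu$-incoherent, and $\mathbb T$ is its tangent space of size $\boldsymbol\rho$, then for all $k\in[m]$ and $j\in[d_k]$ $$\|\mathfrak M_k(\mathcal P_{\mathbb T}(\mathcal G))\|_{2,\infty}\le(3\mu\rho_kd_k^-)^{1/2},$$ $$\|\mathfrak M_k(\mathcal T-\mathcal Y)_{j,\cdot}\|_{H_p}-\|\mathfrak M_k(\mathcal T^*-\mathcal Y)_{j,\cdot}\|_{H_p}\ge\|\mathfrak M_k(\mathcal T-\mathcal T^*)_{j,\cdot}\|_\infty^{-1}\|\mathfrak M_k(\mathcal T-\mathcal T^*)_{j,\cdot}\|_{\rm F}^2-6d_k^-\gamma-d_k^-\delta.$$ (2) For all $\mathcal T\in\mathbb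 M_{\mathbf r}$ with $\|\mathcal T-\mathcal T^*\|_\infty\le C_{m,\mu^*,r^*}(6\gamma+\delta)$ and $\|\mathcal T-\mathcal T^*\|_{\rm F}\ge c_1b_0\sqrt{\mathsf{DoF}_m}$, all $\mathcal G\in\partial f(\mathcal T)$, and $\mathbb T$ the tangent space at $\mathcal T$ given by any Tucker decomposition of $\mathcal T$ of size $\mathbf r$, $$\|\mathcal P_{\mathbb T}(\mathcal G)\|_{\rm F}\le c_2\delta^{-1}\sqrt{m+1}\,\|\mathcal T-\mathcal T^*\|_{\rm F},\qquad f(\mathcal T)-f(\mathcal T^*)\ge(4b_0)^{-1}\|\mathcal T-\mathcal T^*\|_{\rm F}^2.$$ -/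

import Mathlib

open MeasureTheory ProbabilityTheory

noncomputable section

/-- Multi-indices of a `d 0 × ⋯ × d (m-1)` tensor. -/
abbrev MultiIndex {m : ℕ} (d : Fin m → ℕ) : Type := ∀ k : Fin m, Fin (d k)

/-- Real tensors of order `m` and size `d`. The norm of this Euclidean space is the Frobenius norm,
and its inner product is the entrywise one. -/
abbrev Tensor {m : ℕ} (d : Fin m → ℕ) : Type := EuclideanSpace ℝ (MultiIndex d)

/-- Entrywise maximum norm of a finite array. -/
def maxNorm {ι : Type*} (A : ι → ℝ) : ℝ := ⨆ i, |A i|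

/-- Euclidean norm of a finite array. -/
def l2Norm {ι : Type*} [Fintype ι] (A : ι → ℝ) : ℝ := Real.sqrt (∑ i, A i ^ 2)

/-- The `(2,∞)`-norm of a matrix: the largest Euclidean norm of a row. -/
def twoInfNorm {ι κ : Type*} [Fintype κ] (A : Matrix ι κ ℝ) : ℝ := ⨆ i, l2Norm (A i)

/-- The pseudo-Huber loss of a finite array, summed over the entries. -/
def pseudoHuber {ι : Type*} [Fintype ι] (δ : ℝ) (A : ι → ℝ) : ℝ :=
  ∑ i, Real.sqrt (A i ^ 2 + δ ^ 2)

/-- The number of entries of a tensor. -/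
def dStar {m : ℕ} (d : Fin m → ℕ) : ℕ := ∏ k, d k

/-- The product of all dimensions but the `k`-th one. -/
def dMinus {m : ℕ} (d : Fin m → ℕ) (k : Fin m) : ℕ := ∏ j ∈ Finset.univ.erase k, d j

/-- Model complexity `r₁⋯r_m + ∑ d_k r_k`. -/
def DoF {m : ℕ} (d r : Fin m → ℕ) : ℕ := (∏ k, r k) + ∑ k, d k * r k

/-- Mode-`k` matricization: rows are indexed by the `k`-th coordinate, columns by all the others. -/
def matricize {m : ℕ} {d : Fin m → ℕ} (k : Fin m) (T : Tensor d) :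
    Matrix (Fin (d k)) (∀ j : {j : Fin m // j ≠ k}, Fin (d j)) ℝ :=
  fun i I => T ((Equiv.piSplitAt k (fun j => Fin (d j))).symm (i, I))

/-- `T` has Tucker rank exactly `r`. -/
def HasTuckerRank {m : ℕ} {d : Fin m → ℕ} (r : Fin m → ℕ) (T : Tensor d) : Prop :=
  ∀ k, (matricize k T).rank = r k

/-- The set of tensors with Tucker rank bounded by `r`. -/
def tuckerRankLE {m : ℕ} (d r : Fin m → ℕ) : Set (Tensor d) :=
  {T | ∀ k, (matricize k T).rank ≤ r k}

/-- The multilinear product `C ×₁ U₁ ×₂ ⋯ ×ₘ Uₘ`, in coordinates. -/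
def tuckerProd {m : ℕ} {d r : Fin m → ℕ} (C : Tensor r)
    (U : ∀ k, Matrix (Fin (d k)) (Fin (r k)) ℝ) : Tensor d :=
  WithLp.toLp 2 fun i => ∑ a : MultiIndex r, C a * ∏ k, U k (i k) (a k)

/-- `T = C · ⟦U₁, …, Uₘ⟧` with a core of size `r` and factors with orthonormal columns. -/
def IsTuckerDecomp {m : ℕ} {d r : Fin m → ℕ} (T : Tensor d) (C : Tensor r)
    (U : ∀ k, Matrix (Fin (d k)) (Fin (r k)) ℝ) : Prop :=
  (∀ k, (U k).transpose * U k = 1) ∧ T = tuckerProd C U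

/-- `T` has Tucker rank `r` and is `μ`-incoherent. -/
def IsIncoherent {m : ℕ} {d : Fin m → ℕ} (r : Fin m → ℕ) (μ : ℝ) (T : Tensor d) : Prop :=
  HasTuckerRank r T ∧
    ∃ (C : Tensor r) (U : ∀ k, Matrix (Fin (d k)) (Fin (r k)) ℝ), IsTuckerDecomp T C U ∧
      ∀ k, twoInfNorm (U k) ≤ Real.sqrt (μ * r k / d k)

/-- The image of the differential of `(C, U) ↦ C · ⟦U₁, …, Uₘ⟧`: all the tensors
`D · ⟦U₁, …, Uₘ⟧ + ∑ k, C · ⟦U₁, …, V_k, …, Uₘ⟧` with `D`, `V₁`, …, `Vₘ` arbitrary. -/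
def tuckerTangent {m : ℕ} {d r : Fin m → ℕ} (C : Tensor r)
    (U : ∀ k, Matrix (Fin (d k)) (Fin (r k)) ℝ) : Submodule ℝ (Tensor d) :=
  Submodule.span ℝ
    ({H | ∃ D : Tensor r, H = tuckerProd D U} ∪
      {H | ∃ (k : Fin m) (V : Matrix (Fin (d k)) (Fin (r k)) ℝ),
        H = tuckerProd C (Function.update U k V)})

/-- `𝕋` is a tangent space at `T` of the tensors of Tucker rank at most `r`. If `T` has Tucker rank
exactly `r`, then `𝕋` does not depend on the decomposition and is the tangent space at `T` of the
manifold of tensors of Tucker rank `r`. At the singular points, where the rank is smaller, every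
choice of a Tucker decomposition with core of size `r` is admitted. -/
def IsTangentSpace {m : ℕ} {d : Fin m → ℕ} (r : Fin m → ℕ) (T : Tensor d)
    (𝕋 : Submodule ℝ (Tensor d)) : Prop :=
  ∃ (C : Tensor r) (U : ∀ k, Matrix (Fin (d k)) (Fin (r k)) ℝ),
    IsTuckerDecomp T C U ∧ 𝕋 = tuckerTangent C U

/-- `G` is a subgradient of the function `f` at `T`. -/
def IsSubgradient {m : ℕ} {d : Fin m → ℕ} (f : Tensor d → ℝ) (T G : Tensor d) : Prop :=
  ∀ S : Tensor d, f T + inner ℝ G (S - T) ≤ f S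

/-- The constant `72 (5m+1)² 3ᵐ μᵐ r₁⋯rₘ`. -/
def radiusConst {m : ℕ} (μ : ℝ) (r : Fin m → ℕ) : ℝ :=
  72 * (5 * (m : ℝ) + 1) ^ 2 * 3 ^ m * μ ^ m * ((∏ k, r k : ℕ) : ℝ)

/-- `γ = (𝔼 |ξ|^(2+ε))^(1/(2+ε))` for `ξ` with law `ν`. -/
def noiseScale (ν : Measure ℝ) (ε : ℝ) : ℝ := (∫ x, |x| ^ (2 + ε) ∂ν) ^ (1 / (2 + ε))

/-- The noise condition on the law `ν` of an entry: a finite moment of order `2 + ε`, and a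
symmetric Lebesgue density which is at least `1 / b₀` on `|x| ≤ K (6 γ + δ)`. -/
structure NoiseCondition (ν : Measure ℝ) (ε δ b₀ K : ℝ) : Prop where
  eps_pos : 0 < ε
  b₀_pos : 0 < b₀
  moment : Integrable (fun x : ℝ => |x| ^ (2 + ε)) ν
  density : ∃ h : ℝ → ℝ, Measurable h ∧ (∀ x, 0 ≤ h x) ∧
    ν = volume.withDensity (fun x => ENNReal.ofReal (h x)) ∧
    (∀ x, h x = h (-x)) ∧
    ∀ x, |x| ≤ K * (6 * noiseScale ν ε + δ) → b₀⁻¹ ≤ h x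

/-- The observed tensor: signal plus noise. -/
def observed {m : ℕ} {d : Fin m → ℕ} {Ω : Type*} (Tstar : Tensor d)
    (Ξ : MultiIndex d → Ω → ℝ) (ω : Ω) : Tensor d :=
  Tstar + WithLp.toLp 2 fun i => Ξ i ω

/-- The objective function `T ↦ ‖T - Y‖_{Hp}`. -/
def huberObj {m : ℕ} {d : Fin m → ℕ} (δ : ℝ) (Y T : Tensor d) : ℝ :=
  pseudoHuber δ (fun i => (T - Y) i)

/-- The objective function on the `j`-th mode-`k` slice. -/
def huberSlice {m : ℕ} {d : Fin m → ℕ} (δ : ℝ) (Y : Tensor d) (k : Fin m) (j : Fin (d k))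
    (T : Tensor d) : ℝ :=
  pseudoHuber δ (matricize k (T - Y) j)

end

/-!
The randomness enters through three events only; on their complement all the assertions are
deterministic.

*Slices.* The absolute sum of each slice of the noise, which has `n = dMinus d k` entries, is at most
`3 n γ` except with probability of order `n ^ (-1 - min 1 ε)` (`measure_sum_abs_gt_le`): the entries
above `n γ / 2` are excluded by Markov's inequality, and the truncated ones satisfy Chernoff's bound.
Since `√(x² + δ²)` lies between `|x|` and `|x| + δ`, the increment of the loss is at least the `ℓ₁`
norm of `T - Tstar` up to twice the noise and `δ` per entry (`pseudoHuber_sub_ge`), which gives the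
lower bounds of the first phase.

*Fluctuations.* A tensor of Tucker rank at most `r` is the multilinear product of a core and of
factors in a unit ball of a space of dimension `DoF d r` (`exists_tuckerProd_of_rank_le`), and the
product is Lipschitz on this ball if the factors are measured in operator norm
(`norm_tuckerProd_sub_le`). Dudley's chaining on the ball (`chaining_unitBall`) hence bounds every
process with sub-Gaussian increments, uniformly over tensors of low rank, by a multiple of
`√DoF` times the norm (`measure_lowRank_sup_le`); peeling over dyadic shells turns this into a bound
by a small multiple of `‖H‖²` once `‖H‖` exceeds a multiple of `√DoF`
(`measure_lowRank_peeling_le`). Two processes are of this kind: the centred increments of the loss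
and the pairing of a direction with the gradient at the true tensor, which is centred because the
noise is symmetric. Both are sums of independent contractions, so that Hoeffding's inequality applies
(`subGaussianIncrements_centeredSum`).

*Expected loss.* By symmetry of the noise, the expected increment of the pseudo-Huber function under
a shift `t` is half the expectation of a second difference. This is nonnegative by convexity, and it
integrates to at least `t² / b₀` over the interval where the density is at least `1 / b₀`
(`NoiseCondition.sq_div_le_expected_increment`). Half of this growth absorbs the fluctuation.

*Tangent spaces.* Each tangent vector splits into `m + 1` tensors of low rank whose norms it
controls, so the projection of the gradient at the true tensor is small
(`norm_starProjection_tangent_le`), and the gradient is `δ⁻¹`-Lipschitz. For the rows of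
`matricize k` of a projection, the part in the row space of the base point is a projection of the
corresponding row of `G`, and the orthogonal part has columns in the range of `U k`, whose rows are
small by incoherence (`sum_sq_row_starProjection_le`).
-/

/-! ### Chaining over the unit ball of a finite-dimensional space -/

section Chaining

variable {E : Type*} [NormedAddCommGroup E] [NormedSpace ℝ E] [FiniteDimensional ℝ E]

open scoped ENNReal in
/-- Volume bound: the balls of radius `ε / 2` around an `ε`-separated set are disjoint, and they lie
in the ball of radius `1 + ε / 2 ≤ 3 / 2`. -/
lemma card_le_of_separated_unitBall {ε : ℝ} (hε : 0 < ε) (hε1 : ε ≤ 1) (s : Finset E)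
    (hs : ∀ c ∈ s, ‖c‖ ≤ 1) (h : ∀ c ∈ s, ∀ d ∈ s, c ≠ d → ε ≤ ‖c - d‖) :
    (s.card : ℝ) ≤ (3 / ε) ^ Module.finrank ℝ E := by
  borelize E
  let μ : Measure E := Measure.addHaar
  have D : Set.Pairwise (s : Set E)
      (Function.onFun Disjoint fun c => Metric.ball (c : E) (ε / 2)) := by
    rintro c hc d hd hcd
    apply Metric.ball_disjoint_ball
    rw [dist_eq_norm]
    linarith [h c hc d hd hcd]
  have A_subset : (⋃ c ∈ s, Metric.ball (c : E) (ε / 2)) ⊆ Metric.ball (0 : E) (3 / 2) := by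
    refine Set.iUnion₂_subset fun x hx => Metric.ball_subset_ball' ?_
    rw [dist_zero_right]
    linarith [hs x hx]
  have I : (s.card : ℝ≥0∞) * ENNReal.ofReal ((ε / 2) ^ Module.finrank ℝ E) * μ (Metric.ball 0 1) ≤
      ENNReal.ofReal ((3 / 2 : ℝ) ^ Module.finrank ℝ E) * μ (Metric.ball 0 1) :=
    calc
      _ = μ (⋃ c ∈ s, Metric.ball (c : E) (ε / 2)) := by
        rw [measure_biUnion_finset D fun c _ => measurableSet_ball]
        simp only [μ.addHaar_ball_of_pos _ (half_pos hε)]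
        simp only [Finset.sum_const, nsmul_eq_mul, mul_assoc]
      _ ≤ μ (Metric.ball (0 : E) (3 / 2)) := measure_mono A_subset
      _ = _ := by
        simp only [μ.addHaar_ball_of_pos _ (show (0 : ℝ) < 3 / 2 by norm_num)]
  have J : (s.card : ℝ≥0∞) * ENNReal.ofReal ((ε / 2) ^ Module.finrank ℝ E) ≤
      ENNReal.ofReal ((3 / 2 : ℝ) ^ Module.finrank ℝ E) :=
    (ENNReal.mul_le_mul_iff_left (Metric.measure_ball_pos _ _ zero_lt_one).ne'
      measure_ball_lt_top.ne).1 I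
  have K := ENNReal.toReal_le_of_le_ofReal (by positivity) J
  rw [ENNReal.toReal_mul, ENNReal.toReal_natCast, ENNReal.toReal_ofReal (by positivity)] at K
  have e : (3 / ε : ℝ) = (3 / 2) / (ε / 2) := by field_simp
  rw [e, div_pow, le_div_iff₀ (by positivity)]
  exact K

/-- The unit ball has an `ε`-net of at most `(3 / ε) ^ dim` points: a maximal separated set. -/
lemma exists_net_unitBall {ε : ℝ} (hε : 0 < ε) (hε1 : ε ≤ 1) :
    ∃ s : Finset E, (∀ c ∈ s, ‖c‖ ≤ 1) ∧ (s.card : ℝ) ≤ (3 / ε) ^ Module.finrank ℝ E ∧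
      ∀ v : E, ‖v‖ ≤ 1 → ∃ c ∈ s, ‖v - c‖ ≤ ε := by
  classical
  let S : Set ℕ := {n | ∃ s : Finset E, s.card = n ∧ (∀ c ∈ s, ‖c‖ ≤ 1) ∧
    ∀ c ∈ s, ∀ d ∈ s, c ≠ d → ε ≤ ‖c - d‖}
  have hS : BddAbove S := by
    refine ⟨⌊(3 / ε) ^ Module.finrank ℝ E⌋₊, ?_⟩
    rintro n ⟨s, rfl, h1, h2⟩
    exact Nat.le_floor (card_le_of_separated_unitBall hε hε1 s h1 h2)
  obtain ⟨s, hs, h1, h2⟩ : sSup S ∈ S := Nat.sSup_mem ⟨0, ∅, by simp⟩ hS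
  refine ⟨s, h1, card_le_of_separated_unitBall hε hε1 s h1 h2, fun v hv => ?_⟩
  by_contra! hcon
  have hvs : v ∉ s := fun hvs => by
    have := hcon v hvs
    simp at this
    linarith
  have : s.card + 1 ∈ S := by
    refine ⟨insert v s, Finset.card_insert_of_notMem hvs, ?_, ?_⟩
    · intro c hc
      rcases Finset.mem_insert.1 hc with rfl | hc
      exacts [hv, h1 c hc]
    · intro c hc d hd hcd
      rcases Finset.mem_insert.1 hc with hcv | hcs <;>
        rcases Finset.mem_insert.1 hd with hdv | hds
      · exact absurd (hcv.trans hdv.symm) hcd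
      · rw [hcv]; exact (hcon d hds).le
      · rw [norm_sub_rev, hdv]; exact (hcon c hcs).le
      · exact h2 c hcs d hds hcd
  have := le_csSup hS this
  omega

/-- Nets of precision `2⁻ʲ`, the coarsest of which consists of the centre alone. -/
lemma exists_dyadic_nets_unitBall (E : Type*) [NormedAddCommGroup E] [NormedSpace ℝ E]
    [FiniteDimensional ℝ E] :
    ∃ A : ℕ → Finset E, A 0 = {0} ∧ (∀ j, ∀ a ∈ A j, ‖a‖ ≤ 1) ∧
      (∀ j, ((A j).card : ℝ) ≤ (3 * 2 ^ j) ^ Module.finrank ℝ E) ∧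
      ∀ j, ∀ v : E, ‖v‖ ≤ 1 → ∃ a ∈ A j, ‖v - a‖ ≤ (1 / 2) ^ j := by
  have h : ∀ j : ℕ, ∃ s : Finset E, (∀ c ∈ s, ‖c‖ ≤ 1) ∧
      (s.card : ℝ) ≤ (3 * 2 ^ j) ^ Module.finrank ℝ E ∧
      ∀ v : E, ‖v‖ ≤ 1 → ∃ c ∈ s, ‖v - c‖ ≤ (1 / 2) ^ j := fun j => by
    have := exists_net_unitBall (E := E) (ε := (1 / 2) ^ j) (by positivity)
      (pow_le_one₀ (by norm_num) (by norm_num))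
    have e : (3 / (1 / 2) ^ j : ℝ) = 3 * 2 ^ j := by simp [div_eq_mul_inv]
    rwa [e] at this
  choose A hA1 hA2 hA3 using h
  refine ⟨fun j => if j = 0 then {0} else A j, by simp, ?_, ?_, ?_⟩
  · rintro (_ | j) a ha
    · simp at ha; simp [ha]
    · exact hA1 (j + 1) a (by simpa using ha)
  · rintro (_ | j)
    · simpa using one_le_pow₀ (by norm_num : (1 : ℝ) ≤ 3)
    · simpa using hA2 (j + 1)
  · rintro (_ | j) v hv
    · simpa using hv
    · simpa using hA3 (j + 1) v hv

/-- The number of pairs of neighbouring net points of level `j`, times the tail of one increment. -/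
lemma chaining_level_bound {N : ℕ} (hN : 1 ≤ N) {u : ℝ} (hu : 1 ≤ u) (j : ℕ) :
    (3 * 2 ^ j : ℝ) ^ N * ((3 * 2 ^ (j + 1) : ℝ) ^ N *
        (2 * Real.exp (-(4 * Real.sqrt N * u * (j + 3)) ^ 2 / 2))) ≤
      Real.exp (-N * u ^ 2) * (1 / 2) ^ (j + 1) := by
  have hN' : (1 : ℝ) ≤ N := by exact_mod_cast hN
  have he1 : (2 : ℝ) ≤ Real.exp 1 := by linarith [Real.add_one_le_exp (1 : ℝ)]
  have h18 : (18 : ℝ) ≤ Real.exp 3 := by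
    have : Real.exp 3 = Real.exp 1 ^ 3 := by rw [← Real.exp_nat_mul]; norm_num
    rw [this]
    have := Real.exp_one_gt_d9
    calc (18 : ℝ) ≤ 2.7 ^ 3 := by norm_num
      _ ≤ _ := by gcongr; linarith
  have h4 : (4 : ℝ) ≤ Real.exp 2 := by
    have : Real.exp 2 = Real.exp 1 ^ 2 := by rw [← Real.exp_nat_mul]; norm_num
    rw [this]; nlinarith
  have hbase : (3 * 2 ^ j : ℝ) * (3 * 2 ^ (j + 1)) ≤ Real.exp (3 + 2 * j) := by
    calc (3 * 2 ^ j : ℝ) * (3 * 2 ^ (j + 1)) = 18 * 4 ^ j := by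
          rw [show (4 : ℝ) = 2 * 2 by norm_num, mul_pow]; ring
      _ ≤ Real.exp 3 * Real.exp 2 ^ j := by gcongr
      _ = _ := by rw [← Real.exp_nat_mul, ← Real.exp_add]; ring_nf
  have hsq : (4 * Real.sqrt N * u * (j + 3)) ^ 2 = 16 * N * u ^ 2 * (j + 3) ^ 2 := by
    rw [mul_pow, mul_pow, mul_pow, Real.sq_sqrt (by positivity)]; ring
  have hhalf : Real.exp (-((j : ℝ) + 1)) ≤ (1 / 2) ^ (j + 1) := by
    rw [Real.exp_neg, one_div, inv_pow]
    gcongr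
    calc (2 : ℝ) ^ (j + 1) ≤ Real.exp 1 ^ (j + 1) := by gcongr
      _ = _ := by rw [← Real.exp_nat_mul]; simp
  calc (3 * 2 ^ j : ℝ) ^ N * ((3 * 2 ^ (j + 1) : ℝ) ^ N *
        (2 * Real.exp (-(4 * Real.sqrt N * u * (j + 3)) ^ 2 / 2)))
      = ((3 * 2 ^ j : ℝ) * (3 * 2 ^ (j + 1))) ^ N * 2 *
          Real.exp (-(16 * N * u ^ 2 * (j + 3) ^ 2) / 2) := by
          rw [mul_pow (3 * 2 ^ j : ℝ) (3 * 2 ^ (j + 1)) N, hsq]; ring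
    _ ≤ (Real.exp (3 + 2 * j)) ^ N * Real.exp 1 *
          Real.exp (-(16 * N * u ^ 2 * (j + 3) ^ 2) / 2) := by gcongr
    _ = Real.exp (N * (3 + 2 * j) + 1 - 8 * (N * u ^ 2) * (j + 3) ^ 2) := by
        rw [← Real.exp_nat_mul, ← Real.exp_add, ← Real.exp_add]; ring_nf
    _ ≤ Real.exp (-N * u ^ 2 + -((j : ℝ) + 1)) := by
        apply Real.exp_le_exp.2
        have hM : (N : ℝ) ≤ N * u ^ 2 :=
          le_mul_of_one_le_right (by positivity) (one_le_pow₀ hu)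
        have hj : (0 : ℝ) ≤ j := by positivity
        have h1 : (N : ℝ) * (3 + 2 * j) ≤ N * u ^ 2 * (3 + 2 * j) := by gcongr
        have h2 : ((j : ℝ) + 2) ≤ N * u ^ 2 * (j + 2) :=
          le_mul_of_one_le_left (by positivity) (by linarith)
        have h3 : N * u ^ 2 * (6 + 3 * j) ≤ N * u ^ 2 * (8 * ((j : ℝ) + 3) ^ 2) := by
          gcongr; nlinarith
        nlinarith
    _ ≤ _ := by rw [Real.exp_add]; gcongr

variable {Ω : Type*} [MeasurableSpace Ω]

open scoped ENNReal Topology in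
/-- Dudley's chaining bound for a process with continuous paths and sub-Gaussian increments on the
unit ball of a normed space. -/
theorem chaining_unitBall (P : Measure Ω) (Z : E → Ω → ℝ) (hZ : ∀ ω, Continuous fun v => Z v ω)
    {L : ℝ} (hL : 0 ≤ L) (hN : 1 ≤ Module.finrank ℝ E)
    (htail : ∀ v w, ‖v‖ ≤ 1 → ‖w‖ ≤ 1 → ∀ t : ℝ, 0 ≤ t →
      P {ω | t * (L * ‖v - w‖) < |Z v ω - Z w ω|} ≤ ENNReal.ofReal (2 * Real.exp (-t ^ 2 / 2)))
    {u : ℝ} (hu : 1 ≤ u) :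
    P {ω | ∃ v, ‖v‖ ≤ 1 ∧ 64 * L * Real.sqrt (Module.finrank ℝ E) * u < |Z v ω - Z 0 ω|} ≤
      ENNReal.ofReal (Real.exp (-(Module.finrank ℝ E : ℝ) * u ^ 2)) := by
  set N := Module.finrank ℝ E
  obtain ⟨A, hA0, hA1, hAc, hAnet⟩ := exists_dyadic_nets_unitBall E
  let t : ℕ → ℝ := fun j => 4 * Real.sqrt N * u * (j + 3)
  have ht : ∀ j, 0 ≤ t j := fun j => by positivity
  let B : ℕ → E → E → Set Ω := fun j a b =>
    {ω | ‖a - b‖ ≤ 2 * (1 / 2) ^ j ∧ t j * (L * (2 * (1 / 2) ^ j)) < |Z a ω - Z b ω|}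
  have hB : ∀ j, ∀ a ∈ A j, ∀ b ∈ A (j + 1),
      P (B j a b) ≤ ENNReal.ofReal (2 * Real.exp (-t j ^ 2 / 2)) := by
    intro j a ha b hb
    refine le_trans (measure_mono ?_) (htail a b (hA1 j a ha) (hA1 _ b hb) (t j) (ht j))
    rintro ω ⟨h1, h2⟩
    refine lt_of_le_of_lt ?_ h2
    have := ht j
    gcongr
  have hunion : P (⋃ j, ⋃ a ∈ A j, ⋃ b ∈ A (j + 1), B j a b) ≤
      ENNReal.ofReal (Real.exp (-(N : ℝ) * u ^ 2)) := by
    calc P (⋃ j, ⋃ a ∈ A j, ⋃ b ∈ A (j + 1), B j a b)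
        ≤ ∑' j, P (⋃ a ∈ A j, ⋃ b ∈ A (j + 1), B j a b) := measure_iUnion_le _
      _ ≤ ∑' j : ℕ, ENNReal.ofReal (Real.exp (-N * u ^ 2) * (1 / 2) ^ (j + 1)) := by
          refine ENNReal.tsum_le_tsum fun j => ?_
          calc P (⋃ a ∈ A j, ⋃ b ∈ A (j + 1), B j a b)
              ≤ ∑ a ∈ A j, ∑ b ∈ A (j + 1), P (B j a b) :=
                (measure_biUnion_finset_le _ _).trans
                  (Finset.sum_le_sum fun a _ => measure_biUnion_finset_le _ _)
            _ ≤ ∑ a ∈ A j, ∑ b ∈ A (j + 1), ENNReal.ofReal (2 * Real.exp (-t j ^ 2 / 2)) :=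
                Finset.sum_le_sum fun a ha => Finset.sum_le_sum fun b hb => hB j a ha b hb
            _ = ENNReal.ofReal ((A j).card * ((A (j + 1)).card *
                  (2 * Real.exp (-t j ^ 2 / 2)))) := by
                rw [ENNReal.ofReal_mul (by positivity), ENNReal.ofReal_mul (by positivity)]
                simp
            _ ≤ _ := by
                refine ENNReal.ofReal_le_ofReal (le_trans ?_ (chaining_level_bound hN hu j))
                gcongr
                exacts [hAc j, hAc (j + 1)]
      _ = ENNReal.ofReal (∑' j : ℕ, Real.exp (-N * u ^ 2) * (1 / 2) ^ (j + 1)) := by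
          rw [ENNReal.ofReal_tsum_of_nonneg (fun j => by positivity)]
          exact ((summable_geometric_of_lt_one (by norm_num) (by norm_num)).comp_injective
            (add_left_injective 1)).mul_left _
      _ = _ := by
          congr 1
          rw [tsum_mul_left]
          have : ∑' j : ℕ, (1 / 2 : ℝ) ^ (j + 1) = 1 := by
            simp_rw [pow_succ]
            rw [tsum_mul_right, tsum_geometric_two]; norm_num
          rw [this, mul_one]
  refine le_trans (measure_mono ?_) hunion
  rintro ω ⟨v, hv, hlt⟩
  by_contra hω
  simp only [Set.mem_iUnion, not_exists] at hω
  choose π hπA hπ using fun j => hAnet j v hv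
  have hstep : ∀ j, |Z (π j) ω - Z (π (j + 1)) ω| ≤ t j * (L * (2 * (1 / 2) ^ j)) := by
    intro j
    by_contra! hc
    refine hω j (π j) (hπA j) (π (j + 1)) (hπA _) ⟨?_, hc⟩
    have h1 := hπ j
    have h2 := hπ (j + 1)
    have h3 : ‖π j - π (j + 1)‖ ≤ ‖v - π j‖ + ‖v - π (j + 1)‖ := by
      rw [norm_sub_rev v (π j)]
      simpa using norm_add_le (π j - v) (v - π (j + 1))
    have h4 : (1 / 2 : ℝ) ^ (j + 1) ≤ (1 / 2) ^ j :=
      pow_le_pow_of_le_one (by norm_num) (by norm_num) (Nat.le_succ j)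
    linarith
  have hπ0 : π 0 = 0 := by simpa [hA0] using hπA 0
  -- closed form of `∑ i < n, (i + 3) / 2 ^ i`
  have hsum : ∀ n : ℕ, |Z (π n) ω - Z 0 ω| ≤
      8 * L * Real.sqrt N * u * (8 - (2 * n + 8) * (1 / 2) ^ n) := by
    intro n
    induction n with
    | zero => simp [hπ0]
    | succ n ih =>
      have h1 := hstep n
      rw [abs_sub_comm] at h1
      have h2 := abs_add_le (Z (π (n + 1)) ω - Z (π n) ω) (Z (π n) ω - Z 0 ω)
      rw [sub_add_sub_cancel] at h2
      refine (h2.trans (add_le_add h1 ih)).trans (le_of_eq ?_)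
      simp only [t]; push_cast; rw [pow_succ]; ring
  have hlim : Filter.Tendsto π Filter.atTop (𝓝 v) := by
    rw [tendsto_iff_norm_sub_tendsto_zero]
    refine squeeze_zero (fun _ => norm_nonneg _) (fun j => ?_)
      (tendsto_pow_atTop_nhds_zero_of_lt_one (by norm_num : (0 : ℝ) ≤ 1 / 2) (by norm_num))
    rw [norm_sub_rev]; exact hπ j
  have hle : |Z v ω - Z 0 ω| ≤ 64 * L * Real.sqrt N * u := by
    refine le_of_tendsto ((((hZ ω).tendsto v).comp hlim).sub_const _).abs
      (Filter.Eventually.of_forall fun n => (hsum n).trans ?_)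
    have : (0 : ℝ) ≤ (2 * n + 8) * (1 / 2) ^ n := by positivity
    have h8 : 0 ≤ 8 * L * Real.sqrt N * u := by positivity
    nlinarith
  exact absurd hlt (not_lt.2 hle)

end Chaining

/-! ### Matricization and the multilinear product -/

section TuckerAlgebra

variable {m : ℕ} {d r : Fin m → ℕ}

lemma matricize_add (k : Fin m) (S T : Tensor d) :
    matricize k (S + T) = matricize k S + matricize k T := rfl

lemma matricize_sub (k : Fin m) (S T : Tensor d) :
    matricize k (S - T) = matricize k S - matricize k T := rfl

lemma matricize_smul (k : Fin m) (c : ℝ) (T : Tensor d) :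
    matricize k (c • T) = c • matricize k T := rfl

lemma matricize_split (k : Fin m) (T : Tensor d) (i : MultiIndex d) :
    matricize k T (i k) (fun j => i j) = T i :=
  congrArg T ((Equiv.piSplitAt k fun j => Fin (d j)).symm_apply_apply i)

lemma matricize_injective (k : Fin m) : Function.Injective (matricize (d := d) k) := by
  intro S T h
  ext i
  rw [← matricize_split k S, ← matricize_split k T, h]

/-- Summation over the entries of a tensor, row by row of a matricization. -/
lemma sum_multiIndex_split (k : Fin m) (f : MultiIndex d → ℝ) :
    ∑ i, f i = ∑ a, ∑ I, f ((Equiv.piSplitAt k fun j => Fin (d j)).symm (a, I)) := by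
  rw [← (Equiv.piSplitAt k fun j => Fin (d j)).symm.sum_comp, Fintype.sum_prod_type]

lemma inner_eq_sum_matricize (k : Fin m) (S T : Tensor d) :
    inner ℝ S T = ∑ a, ∑ I, matricize k S a I * matricize k T a I := by
  simp only [PiLp.inner_apply, RCLike.inner_apply, conj_trivial]
  rw [sum_multiIndex_split k]
  exact Finset.sum_congr rfl fun a _ => Finset.sum_congr rfl fun I _ => mul_comm _ _

lemma norm_sq_eq_sum_matricize (k : Fin m) (T : Tensor d) :
    ‖T‖ ^ 2 = ∑ a, ∑ I, matricize k T a I ^ 2 := by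
  rw [EuclideanSpace.real_norm_sq_eq, sum_multiIndex_split k]
  rfl

/-- The matrix `B` with `𝔐_k (C · ⟦U⟧) = U_k B`; it does not involve the factor `U_k`. -/
def tuckerCofactor (k : Fin m) (C : Tensor r) (U : ∀ k, Matrix (Fin (d k)) (Fin (r k)) ℝ) :
    Matrix (Fin (r k)) (∀ j : {j : Fin m // j ≠ k}, Fin (d j)) ℝ :=
  fun a I => ∑ J : (∀ j : {j : Fin m // j ≠ k}, Fin (r j)),
    matricize k C a J * ∏ j : {j : Fin m // j ≠ k}, U j (I j) (J j)

lemma matricize_tuckerProd (k : Fin m) (C : Tensor r)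
    (U : ∀ k, Matrix (Fin (d k)) (Fin (r k)) ℝ) :
    matricize k (tuckerProd C U) = U k * tuckerCofactor k C U := by
  ext i I
  rw [Matrix.mul_apply]
  change ∑ a : MultiIndex r, C a * ∏ j, U j ((Equiv.piSplitAt k fun j => Fin (d j)).symm (i, I) j)
    (a j) = _
  rw [sum_multiIndex_split k]
  refine Finset.sum_congr rfl fun a _ => ?_
  rw [tuckerCofactor, Finset.mul_sum]
  refine Finset.sum_congr rfl fun J _ => ?_
  rw [Fintype.prod_eq_mul_prod_subtype_ne _ k]
  have h : ∀ j : {j : Fin m // j ≠ k},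
      U j ((Equiv.piSplitAt k fun j => Fin (d j)).symm (i, I) j)
        ((Equiv.piSplitAt k fun j => Fin (r j)).symm (a, J) j) = U j (I j) (J j) := by
    rintro ⟨j, hj⟩
    simp [Equiv.piSplitAt, hj]
  simp only [h]
  simp only [Equiv.piSplitAt, ne_eq, Equiv.coe_fn_symm_mk, dite_true]
  simp only [matricize, Equiv.piSplitAt, Equiv.coe_fn_symm_mk]
  ring

lemma tuckerCofactor_update (k : Fin m) (C : Tensor r)
    (U : ∀ k, Matrix (Fin (d k)) (Fin (r k)) ℝ) (V : Matrix (Fin (d k)) (Fin (r k)) ℝ) :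
    tuckerCofactor k C (Function.update U k V) = tuckerCofactor k C U := by
  ext a I
  refine Finset.sum_congr rfl fun J _ => ?_
  congr 1
  refine Finset.prod_congr rfl fun j _ => ?_
  rw [Function.update_of_ne j.2]

lemma matricize_tuckerProd_update (k : Fin m) (C : Tensor r)
    (U : ∀ k, Matrix (Fin (d k)) (Fin (r k)) ℝ) (V : Matrix (Fin (d k)) (Fin (r k)) ℝ) :
    matricize k (tuckerProd C (Function.update U k V)) = V * tuckerCofactor k C U := by
  rw [matricize_tuckerProd, Function.update_self, tuckerCofactor_update]

lemma tuckerProd_apply (C : Tensor r) (U : ∀ k, Matrix (Fin (d k)) (Fin (r k)) ℝ)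
    (i : MultiIndex d) : tuckerProd C U i = ∑ a : MultiIndex r, C a * ∏ k, U k (i k) (a k) := rfl

lemma tuckerProd_add_left (C D : Tensor r) (U : ∀ k, Matrix (Fin (d k)) (Fin (r k)) ℝ) :
    tuckerProd (C + D) U = tuckerProd C U + tuckerProd D U := by
  ext i
  simp [tuckerProd_apply, add_mul, Finset.sum_add_distrib]

lemma tuckerProd_smul_left (c : ℝ) (C : Tensor r) (U : ∀ k, Matrix (Fin (d k)) (Fin (r k)) ℝ) :
    tuckerProd (c • C) U = c • tuckerProd C U := by
  ext i
  simp [tuckerProd_apply, mul_assoc, Finset.mul_sum]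

lemma tuckerProd_sub_left (C D : Tensor r) (U : ∀ k, Matrix (Fin (d k)) (Fin (r k)) ℝ) :
    tuckerProd (C - D) U = tuckerProd C U - tuckerProd D U := by
  ext i
  simp [tuckerProd_apply, sub_mul, Finset.sum_sub_distrib]

lemma tuckerProd_zero_left (U : ∀ k, Matrix (Fin (d k)) (Fin (r k)) ℝ) :
    tuckerProd (0 : Tensor r) U = 0 := by
  ext i
  simp [tuckerProd_apply]

/-- With a fixed core, the multilinear product is a multilinear map of the factors. -/
def tuckerMultilinear (C : Tensor r) :
    MultilinearMap ℝ (fun k => Matrix (Fin (d k)) (Fin (r k)) ℝ) (Tensor d) where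
  toFun U := tuckerProd C U
  map_update_add' := by
    intro inst U k V W
    rw [Subsingleton.elim inst (instDecidableEqFin m)]
    apply matricize_injective k
    rw [matricize_add]
    simp only [matricize_tuckerProd_update, Matrix.add_mul]
  map_update_smul' := by
    intro inst U k c V
    rw [Subsingleton.elim inst (instDecidableEqFin m)]
    apply matricize_injective k
    rw [matricize_smul]
    simp only [matricize_tuckerProd_update, Matrix.smul_mul]

lemma tuckerProd_one (T : Tensor d) : tuckerProd T (fun _ => 1) = T := by
  ext i
  rw [tuckerProd_apply, Finset.sum_eq_single i]
  · simp
  · intro a _ ha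
    obtain ⟨k, hk⟩ := Function.ne_iff.1 ha
    rw [Finset.prod_eq_zero (Finset.mem_univ k) (by simp [Ne.symm hk]), mul_zero]
  · simp

lemma tuckerProd_tuckerProd {e : Fin m → ℕ} (C : Tensor r)
    (A : ∀ k, Matrix (Fin (d k)) (Fin (r k)) ℝ) (B : ∀ k, Matrix (Fin (e k)) (Fin (d k)) ℝ) :
    tuckerProd (tuckerProd C A) B = tuckerProd C (fun k => B k * A k) := by
  ext i
  simp only [tuckerProd_apply, Matrix.mul_apply, Finset.prod_univ_sum, Fintype.piFinset_univ]
  simp_rw [Finset.sum_mul, Finset.mul_sum]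
  rw [Finset.sum_comm]
  refine Finset.sum_congr rfl fun a _ => Finset.sum_congr rfl fun b _ => ?_
  rw [Finset.prod_mul_distrib]
  ring

/-- Mode-`k` multiplication acts on the left of the mode-`k` matricization. -/
lemma matricize_modeProd (k : Fin m) (T : Tensor d) (Q : Matrix (Fin (d k)) (Fin (d k)) ℝ) :
    matricize k (tuckerProd T (Function.update (fun _ => 1) k Q)) = Q * matricize k T := by
  rw [matricize_tuckerProd_update]
  congr 1
  conv_rhs => rw [← tuckerProd_one T, matricize_tuckerProd, Matrix.one_mul]

lemma inner_tuckerProd (C : Tensor r) (U : ∀ k, Matrix (Fin (d k)) (Fin (r k)) ℝ)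
    (T : Tensor d) :
    inner ℝ (tuckerProd C U) T = inner ℝ C (tuckerProd T fun k => (U k).transpose) := by
  simp only [PiLp.inner_apply, RCLike.inner_apply, conj_trivial, tuckerProd_apply,
    Finset.mul_sum, Finset.sum_mul, Matrix.transpose_apply]
  rw [Finset.sum_comm]
  exact Finset.sum_congr rfl fun a _ => Finset.sum_congr rfl fun b _ => by ring

/-- A tensor is fixed by a multilinear product if it is fixed in every mode. -/
lemma tuckerProd_eq_self (T : Tensor d) (Q : ∀ k, Matrix (Fin (d k)) (Fin (d k)) ℝ)
    (h : ∀ k, Q k * matricize k T = matricize k T) : tuckerProd T Q = T := by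
  have key : ∀ S : Finset (Fin m), tuckerProd T (fun k => if k ∈ S then Q k else 1) = T := by
    intro S
    induction S using Finset.induction with
    | empty => simpa using tuckerProd_one T
    | insert k S hk ih =>
      have e : (fun j => if j ∈ insert k S then Q j else 1) = fun j =>
          (if j ∈ S then Q j else 1) *
            (Function.update (fun j => (1 : Matrix (Fin (d j)) (Fin (d j)) ℝ)) k (Q k) j) := by
        funext j
        by_cases hj : j = k
        · subst hj; simp [hk]
        · simp [hj]
      have hk1 : tuckerProd T (Function.update (fun _ => 1) k (Q k)) = T :=
        matricize_injective k (by rw [matricize_modeProd, h])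
      rw [e, ← tuckerProd_tuckerProd, hk1, ih]
  simpa using key Finset.univ

section L2OpNorm

open scoped Matrix.Norms.L2Operator

lemma norm_modeProd_le (k : Fin m) (T : Tensor d) (Q : Matrix (Fin (d k)) (Fin (d k)) ℝ) :
    ‖tuckerProd T (Function.update (fun _ => 1) k Q)‖ ≤ ‖Q‖ * ‖T‖ := by
  refine le_of_sq_le_sq ?_ (by positivity)
  rw [mul_pow, norm_sq_eq_sum_matricize k, norm_sq_eq_sum_matricize k, matricize_modeProd,
    Finset.sum_comm, Finset.sum_comm (γ := Fin (d k)), Finset.mul_sum]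
  refine Finset.sum_le_sum fun I _ => ?_
  have := Matrix.l2_opNorm_mulVec Q (WithLp.toLp 2 fun a => matricize k T a I)
  have h2 := pow_le_pow_left₀ (norm_nonneg _) this 2
  rw [mul_pow, EuclideanSpace.real_norm_sq_eq, EuclideanSpace.real_norm_sq_eq] at h2
  simpa [Matrix.mul_apply, Matrix.mulVec, dotProduct] using h2

lemma norm_tuckerProd_square_le (T : Tensor d) (Q : ∀ k, Matrix (Fin (d k)) (Fin (d k)) ℝ) :
    ‖tuckerProd T Q‖ ≤ (∏ k, ‖Q k‖) * ‖T‖ := by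
  have key : ∀ S : Finset (Fin m),
      ‖tuckerProd T (fun k => if k ∈ S then Q k else 1)‖ ≤ (∏ k ∈ S, ‖Q k‖) * ‖T‖ := by
    intro S
    induction S using Finset.induction with
    | empty => simp [tuckerProd_one]
    | insert k S hk ih =>
      have e : (fun j => if j ∈ insert k S then Q j else 1) = fun j =>
          (Function.update (fun j => (1 : Matrix (Fin (d j)) (Fin (d j)) ℝ)) k (Q k) j) *
            (if j ∈ S then Q j else 1) := by
        funext j
        by_cases hj : j = k
        · subst hj; simp [hk]
        · simp [hj]
      rw [e, ← tuckerProd_tuckerProd, Finset.prod_insert hk, mul_assoc]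
      exact (norm_modeProd_le _ _ _).trans (by gcongr)
  simpa using key Finset.univ

lemma norm_transpose_l2 {a b : ℕ} (W : Matrix (Fin a) (Fin b) ℝ) : ‖W.transpose‖ = ‖W‖ := by
  rw [← Matrix.conjTranspose_eq_transpose_of_trivial, Matrix.l2_opNorm_conjTranspose]

lemma norm_transpose_mul_self_l2 {a b : ℕ} (W : Matrix (Fin a) (Fin b) ℝ) :
    ‖W.transpose * W‖ = ‖W‖ * ‖W‖ := by
  rw [← Matrix.conjTranspose_eq_transpose_of_trivial, Matrix.l2_opNorm_conjTranspose_mul_self]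

/-- The Frobenius norm of a multilinear product is bounded by the operator norms of the factors.
The adjoint reduces the claim to square factors `U_kᵀ U_k`, which act mode by mode. -/
lemma norm_tuckerProd_le (C : Tensor r) (U : ∀ k, Matrix (Fin (d k)) (Fin (r k)) ℝ) :
    ‖tuckerProd C U‖ ≤ ‖C‖ * ∏ k, ‖U k‖ := by
  refine le_of_sq_le_sq ?_ (by positivity)
  calc ‖tuckerProd C U‖ ^ 2 = inner ℝ C (tuckerProd C fun k => (U k).transpose * U k) := by
        rw [← real_inner_self_eq_norm_sq, inner_tuckerProd, tuckerProd_tuckerProd]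
    _ ≤ ‖C‖ * ‖tuckerProd C fun k => (U k).transpose * U k‖ := real_inner_le_norm _ _
    _ ≤ ‖C‖ * ((∏ k, ‖(U k).transpose * U k‖) * ‖C‖) := by
        gcongr; exact norm_tuckerProd_square_le _ _
    _ = _ := by
        simp only [norm_transpose_mul_self_l2, Finset.prod_mul_distrib]; ring

/-- `W` has norm at most one if `W Wᵀ` is the orthogonal projection onto the range of `W`. -/
lemma norm_le_one_of_mul_transpose_mul {a b : ℕ} {W : Matrix (Fin a) (Fin b) ℝ}
    (h : W * W.transpose * W = W) : ‖W‖ ≤ 1 := by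
  have h1 : ‖W * W.transpose‖ = ‖W‖ * ‖W‖ := by
    have := norm_transpose_mul_self_l2 W.transpose
    rwa [Matrix.transpose_transpose, norm_transpose_l2] at this
  have h2 : (W * W.transpose).transpose * (W * W.transpose) = W * W.transpose := by
    rw [Matrix.transpose_mul, Matrix.transpose_transpose, ← Matrix.mul_assoc, h]
  have h3 := norm_transpose_mul_self_l2 (W * W.transpose)
  rw [h2, h1] at h3
  by_contra! hc
  have hpos : 1 < ‖W‖ * ‖W‖ := by nlinarith
  nlinarith

lemma norm_one_sub_mul_transpose_le {a b : ℕ} {W : Matrix (Fin a) (Fin b) ℝ}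
    (h : W.transpose * W = 1) : ‖1 - W * W.transpose‖ ≤ 1 := by
  have hidem : W * W.transpose * (W * W.transpose) = W * W.transpose := by
    rw [Matrix.mul_assoc, ← Matrix.mul_assoc W.transpose, h, Matrix.one_mul]
  have hT : (1 - W * W.transpose).transpose = 1 - W * W.transpose := by
    rw [Matrix.transpose_sub, Matrix.transpose_one, Matrix.transpose_mul,
      Matrix.transpose_transpose]
  have hsq : (1 - W * W.transpose) * (1 - W * W.transpose) = 1 - W * W.transpose := by
    rw [Matrix.sub_mul, Matrix.mul_sub, Matrix.mul_sub, hidem]; simp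
  exact norm_le_one_of_mul_transpose_mul (by rw [hT, hsq, hsq])

/-- A matrix of rank at most `b` has its columns in the range of some `W` with `b` columns which are
orthonormal or zero. -/
lemma exists_factor_of_rank_le {a b : ℕ} {ι : Type*} [Fintype ι] (M : Matrix (Fin a) ι ℝ)
    (hM : M.rank ≤ b) :
    ∃ W : Matrix (Fin a) (Fin b) ℝ, ‖W‖ ≤ 1 ∧ W * W.transpose * M = M := by
  classical
  let S : Submodule ℝ (EuclideanSpace ℝ (Fin a)) :=
    (LinearMap.range M.mulVecLin).map (WithLp.linearEquiv 2 ℝ (Fin a → ℝ)).symm.toLinearMap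
  have hS : Module.finrank ℝ S ≤ b := by
    rw [LinearEquiv.finrank_map_eq]; exact hM
  let o := stdOrthonormalBasis ℝ S
  let W : Matrix (Fin a) (Fin b) ℝ := fun i c =>
    if h : (c : ℕ) < Module.finrank ℝ S then (o ⟨c, h⟩ : EuclideanSpace ℝ (Fin a)) i else 0
  -- `W Wᵀ` is the orthogonal projection onto `S`
  have hW : ∀ x ∈ S, (W * W.transpose).mulVec (WithLp.ofLp x) = WithLp.ofLp x := by
    intro x hx
    have hx' := o.sum_repr' ⟨x, hx⟩
    have hx'' := congrArg (Subtype.val) hx'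
    simp only [Submodule.coe_sum, Submodule.coe_smul, Submodule.coe_inner] at hx''
    funext i
    conv_rhs => rw [← hx'']
    rw [← Matrix.mulVec_mulVec]
    simp only [Matrix.mulVec, dotProduct, Matrix.transpose_apply, WithLp.ofLp_sum,
      WithLp.ofLp_smul, Finset.sum_apply, Pi.smul_apply, smul_eq_mul]
    have hinj : Function.Injective (Fin.castLE hS) := Fin.castLE_injective hS
    rw [← Finset.sum_subset (Finset.subset_univ (Finset.univ.map ⟨Fin.castLE hS, hinj⟩))]
    · rw [Finset.sum_map]
      refine Finset.sum_congr rfl fun c _ => ?_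
      simp [W, PiLp.inner_apply, mul_comm]
    · intro c _ hc
      have : ¬ (c : ℕ) < Module.finrank ℝ S := fun h => hc (by
        simp only [Finset.mem_map, Finset.mem_univ, true_and, Function.Embedding.coeFn_mk]
        exact ⟨⟨c, h⟩, rfl⟩)
      simp [W, this]
  refine ⟨W, norm_le_one_of_mul_transpose_mul ?_, ?_⟩
  · ext i c
    suffices hmem : WithLp.toLp 2 (W.col c) ∈ S from congrFun (hW _ hmem) i
    by_cases h : (c : ℕ) < Module.finrank ℝ S
    · have : WithLp.toLp 2 (W.col c) = (o ⟨c, h⟩ : EuclideanSpace ℝ (Fin a)) := by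
        ext i; exact dif_pos h
      rw [this]; exact (o ⟨c, h⟩).2
    · have : WithLp.toLp 2 (W.col c) = (0 : EuclideanSpace ℝ (Fin a)) := by
        ext i; exact dif_neg h
      rw [this]; exact S.zero_mem
  · ext i c
    suffices hmem : WithLp.toLp 2 (M.col c) ∈ S from congrFun (hW _ hmem) i
    refine Submodule.mem_map.2 ⟨M.col c, ⟨Pi.single c 1, ?_⟩, rfl⟩
    simp

/-- Higher order singular value decomposition, up to the normalization of the factors. -/
lemma exists_tuckerProd_of_rank_le {T : Tensor d} (hT : T ∈ tuckerRankLE d r) :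
    ∃ (D : Tensor r) (W : ∀ k, Matrix (Fin (d k)) (Fin (r k)) ℝ),
      T = tuckerProd D W ∧ ‖D‖ ≤ ‖T‖ ∧ ∀ k, ‖W k‖ ≤ 1 := by
  choose W hW1 hW2 using fun k => exists_factor_of_rank_le (matricize k T) (hT k)
  refine ⟨tuckerProd T fun k => (W k).transpose, W, ?_, ?_, hW1⟩
  · rw [tuckerProd_tuckerProd, tuckerProd_eq_self T _ hW2]
  · refine (norm_tuckerProd_le _ _).trans (mul_le_of_le_one_right (norm_nonneg _) ?_)
    exact Finset.prod_le_one (fun _ _ => norm_nonneg _) fun k _ => by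
      rw [norm_transpose_l2]; exact hW1 k

/-- On the unit ball of cores and factors, the multilinear product is `(m + 1)`-Lipschitz. -/
lemma norm_tuckerProd_sub_le
    (v w : Tensor r × (∀ k, Matrix (Fin (d k)) (Fin (r k)) ℝ)) (hv : ‖v‖ ≤ 1) (hw : ‖w‖ ≤ 1) :
    ‖tuckerProd v.1 v.2 - tuckerProd w.1 w.2‖ ≤ (m + 1) * ‖v - w‖ := by
  have hv1 := (norm_fst_le v).trans hv
  have hv2 := (norm_snd_le v).trans hv
  have hw1 := (norm_fst_le w).trans hw
  have hw2 := (norm_snd_le w).trans hw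
  have e : tuckerProd v.1 v.2 - tuckerProd w.1 w.2 =
      tuckerProd (v.1 - w.1) v.2 + (tuckerProd w.1 v.2 - tuckerProd w.1 w.2) := by
    rw [tuckerProd_sub_left]; abel
  have h1 : ‖tuckerProd (v.1 - w.1) v.2‖ ≤ ‖v - w‖ := by
    refine (norm_tuckerProd_le _ _).trans ?_
    calc _ ≤ ‖v.1 - w.1‖ * 1 := by
          gcongr
          exact Finset.prod_le_one (fun _ _ => norm_nonneg _)
            fun k _ => (norm_le_pi_norm v.2 k).trans hv2
      _ ≤ _ := by rw [mul_one]; exact norm_fst_le (v - w)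
  have h2 : ‖tuckerProd w.1 v.2 - tuckerProd w.1 w.2‖ ≤ m * ‖v - w‖ := by
    have := (tuckerMultilinear (d := d) w.1).norm_image_sub_le_of_bound zero_le_one (fun U => by
      refine (norm_tuckerProd_le w.1 U).trans ?_
      gcongr) v.2 w.2
    refine this.trans ?_
    rw [one_mul, Fintype.card_fin]
    have hmax : max ‖v.2‖ ‖w.2‖ ^ (m - 1) ≤ 1 :=
      pow_le_one₀ (le_max_of_le_left (norm_nonneg _)) (max_le hv2 hw2)
    calc (m : ℝ) * max ‖v.2‖ ‖w.2‖ ^ (m - 1) * ‖v.2 - w.2‖ ≤ m * 1 * ‖v - w‖ := by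
          gcongr; exact norm_snd_le (v - w)
      _ = _ := by ring
  rw [e]
  exact (norm_add_le _ _).trans (by linarith)

lemma continuous_tuckerProd :
    Continuous fun v : Tensor r × (∀ k, Matrix (Fin (d k)) (Fin (r k)) ℝ) =>
      tuckerProd v.1 v.2 := by
  refine (PiLp.continuous_toLp 2 _).comp (continuous_pi fun i => ?_)
  refine continuous_finsetSum _ fun a _ => Continuous.mul (by fun_prop) ?_
  refine continuous_finsetProd _ fun k _ => ?_
  exact (((continuous_apply k).comp continuous_snd).matrix_elem (i k) (a k))

lemma finrank_tuckerParam (d r : Fin m → ℕ) :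
    Module.finrank ℝ (Tensor r × (∀ k, Matrix (Fin (d k)) (Fin (r k)) ℝ)) = DoF d r := by
  rw [Module.finrank_prod, Module.finrank_pi_fintype, finrank_euclideanSpace, DoF]
  simp [Module.finrank_matrix, Fintype.card_pi]

end L2OpNorm

end TuckerAlgebra

/-! ### Uniform bounds over tensors of low Tucker rank -/

section LowRankProcess

variable {m : ℕ} {d r : Fin m → ℕ} {Ω : Type*} [MeasurableSpace Ω]

lemma rank_sub_le_add {α β : Type*} [Fintype α] [Fintype β] (A B : Matrix α β ℝ) :
    (A - B).rank ≤ A.rank + B.rank := by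
  unfold Matrix.rank
  refine le_trans (Submodule.finrank_mono ?_)
    (Submodule.finrank_add_le_finrank_add_finrank (LinearMap.range A.mulVecLin)
      (LinearMap.range B.mulVecLin))
  rintro _ ⟨x, rfl⟩
  rw [Matrix.mulVecLin_apply, Matrix.sub_mulVec]
  exact Submodule.sub_mem_sup ⟨x, rfl⟩ ⟨x, rfl⟩

lemma sub_mem_tuckerRankLE {S T : Tensor d} (hS : S ∈ tuckerRankLE d r)
    (hT : T ∈ tuckerRankLE d r) : S - T ∈ tuckerRankLE d fun k => 2 * r k := fun k => by
  rw [matricize_sub]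
  exact (rank_sub_le_add _ _).trans (by
    have h1 : _ ≤ r k := hS k
    have h2 : _ ≤ r k := hT k
    change _ ≤ 2 * r k
    omega)

lemma tuckerProd_mem_tuckerRankLE (C : Tensor r) (U : ∀ k, Matrix (Fin (d k)) (Fin (r k)) ℝ) :
    tuckerProd C U ∈ tuckerRankLE d r := fun k => by
  rw [matricize_tuckerProd]
  exact (Matrix.rank_mul_le_left _ _).trans (Matrix.rank_le_width _)

lemma smul_mem_tuckerRankLE {T : Tensor d} (c : ℝ) (hT : T ∈ tuckerRankLE d r) :
    c • T ∈ tuckerRankLE d r := by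
  obtain ⟨D, W, rfl, -⟩ := exists_tuckerProd_of_rank_le hT
  rw [← tuckerProd_smul_left]
  exact tuckerProd_mem_tuckerRankLE _ _

lemma tuckerRankLE_mono {r' : Fin m → ℕ} (h : ∀ k, r k ≤ r' k) :
    tuckerRankLE d r ⊆ tuckerRankLE d r' := fun _ hT k => (hT k).trans (h k)

/-- The increments of the process `X` have Gaussian tails in the Frobenius metric. -/
def SubGaussianIncrements (P : Measure Ω) (X : Tensor d → Ω → ℝ) : Prop :=
  ∀ S T : Tensor d, ∀ t : ℝ, 0 ≤ t →
    P {ω | t * ‖S - T‖ < |X S ω - X T ω|} ≤ ENNReal.ofReal (2 * Real.exp (-t ^ 2 / 2))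

section
open scoped Matrix.Norms.L2Operator

/-- The core and the factors range over a unit ball of dimension `DoF d r`, on which the multilinear
product is Lipschitz, so that chaining over this ball applies. -/
theorem measure_lowRank_sup_le (P : Measure Ω) (X : Tensor d → Ω → ℝ)
    (hXc : ∀ ω, Continuous fun T => X T ω) (hX : SubGaussianIncrements P X)
    (hN : 1 ≤ DoF d r) {τ : ℝ} (hτ : 0 < τ) {u : ℝ} (hu : 1 ≤ u) :
    P {ω | ∃ H ∈ tuckerRankLE d r, ‖H‖ ≤ τ ∧
        64 * (τ * (m + 1)) * Real.sqrt (DoF d r) * u < |X H ω - X 0 ω|} ≤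
      ENNReal.ofReal (Real.exp (-(DoF d r : ℝ) * u ^ 2)) := by
  let V := Tensor r × (∀ k, Matrix (Fin (d k)) (Fin (r k)) ℝ)
  let Z : V → Ω → ℝ := fun v ω => X (τ • tuckerProd v.1 v.2) ω
  have hfr : Module.finrank ℝ V = DoF d r := finrank_tuckerParam d r
  have key := chaining_unitBall P Z
    (fun ω => (hXc ω).comp (continuous_tuckerProd.const_smul τ))
    (L := τ * (m + 1)) (by positivity) (by rw [hfr]; exact hN) (by
      intro v w hv hw t ht
      refine le_trans (measure_mono ?_)
        (hX (τ • tuckerProd v.1 v.2) (τ • tuckerProd w.1 w.2) t ht)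
      intro ω hω
      refine lt_of_le_of_lt ?_ (show t * (τ * (m + 1) * ‖v - w‖) < _ from hω)
      rw [← smul_sub, norm_smul, Real.norm_of_nonneg hτ.le, mul_assoc τ]
      have := norm_tuckerProd_sub_le v w hv hw
      gcongr) hu
  rw [hfr] at key
  refine le_trans (measure_mono ?_) key
  rintro ω ⟨H, hH, hHτ, hlt⟩
  obtain ⟨D, W, rfl, hD, hW⟩ := exists_tuckerProd_of_rank_le hH
  refine ⟨(τ⁻¹ • D, W), ?_, ?_⟩
  · refine norm_prod_le_iff.2 ⟨?_, (pi_norm_le_iff_of_nonneg zero_le_one).2 hW⟩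
    rw [norm_smul, norm_inv, Real.norm_of_nonneg hτ.le, inv_mul_le_iff₀ hτ, mul_one]
    exact hD.trans hHτ
  · have h1 : Z (τ⁻¹ • D, W) ω = X (tuckerProd D W) ω := by
      simp only [Z, tuckerProd_smul_left, smul_smul, mul_inv_cancel₀ hτ.ne', one_smul]
    have h0 : Z 0 ω = X 0 ω := by
      simp only [Z, Prod.fst_zero, tuckerProd_zero_left, smul_zero]
    rw [h1, h0]
    exact hlt

end

/-- Peeling over dyadic shells: beyond the radius `ρ₀`, the process is bounded by a small multiple
of the squared norm. -/
theorem measure_lowRank_peeling_le (P : Measure Ω) (X : Tensor d → Ω → ℝ)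
    (hXc : ∀ ω, Continuous fun T => X T ω) (hX : SubGaussianIncrements P X)
    (hN : 1 ≤ DoF d r) {ρ₀ : ℝ} (hρ₀ : 0 < ρ₀) :
    P {ω | ∃ H ∈ tuckerRankLE d r, ρ₀ ≤ ‖H‖ ∧
        128 * (m + 1) * Real.sqrt (DoF d r) * ‖H‖ ^ 2 / ρ₀ < |X H ω - X 0 ω|} ≤
      ENNReal.ofReal (2 * Real.exp (-(DoF d r : ℝ))) := by
  have hN' : (1 : ℝ) ≤ DoF d r := by exact_mod_cast hN
  set B : ℕ → Set Ω := fun s => {ω | ∃ H ∈ tuckerRankLE d r, ‖H‖ ≤ 2 ^ (s + 1) * ρ₀ ∧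
        64 * (2 ^ (s + 1) * ρ₀ * (m + 1)) * Real.sqrt (DoF d r) * 2 ^ s < |X H ω - X 0 ω|}
  have hB : ∀ s, P (B s) ≤ ENNReal.ofReal (Real.exp (-(DoF d r : ℝ)) * (1 / 2) ^ s) := by
    intro s
    refine (measure_lowRank_sup_le P X hXc hX hN (τ := 2 ^ (s + 1) * ρ₀) (by positivity)
      (u := 2 ^ s) (one_le_pow₀ one_le_two)).trans (ENNReal.ofReal_le_ofReal ?_)
    have h1 : (1 : ℝ) + s ≤ (2 ^ s) ^ 2 := by
      have h2 : (s : ℝ) + 1 ≤ 2 ^ s := by exact_mod_cast Nat.lt_two_pow_self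
      have h3 : (1 : ℝ) ≤ 2 ^ s := one_le_pow₀ one_le_two
      nlinarith
    have hhalf : Real.exp (-(s : ℝ)) ≤ (1 / 2) ^ s := by
      have he : (2 : ℝ) ≤ Real.exp 1 := by linarith [Real.add_one_le_exp (1 : ℝ)]
      rw [Real.exp_neg, one_div, inv_pow]
      gcongr
      calc (2 : ℝ) ^ s ≤ Real.exp 1 ^ s := by gcongr
        _ = _ := by rw [← Real.exp_nat_mul]; simp
    calc Real.exp (-(DoF d r : ℝ) * (2 ^ s) ^ 2) ≤ Real.exp (-(DoF d r : ℝ) + -s) := by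
          apply Real.exp_le_exp.2
          have hs : (s : ℝ) ≤ DoF d r * s := le_mul_of_one_le_left (by positivity) hN'
          have : (DoF d r : ℝ) * (1 + s) ≤ DoF d r * (2 ^ s) ^ 2 := by gcongr
          linarith
      _ ≤ _ := by rw [Real.exp_add]; gcongr
  have hsub : {ω | ∃ H ∈ tuckerRankLE d r, ρ₀ ≤ ‖H‖ ∧
        128 * (m + 1) * Real.sqrt (DoF d r) * ‖H‖ ^ 2 / ρ₀ < |X H ω - X 0 ω|} ⊆ ⋃ s, B s := by
    rintro ω ⟨H, hH, hHρ, hlt⟩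
    obtain ⟨s, hs1, hs2⟩ := exists_nat_pow_near ((one_le_div hρ₀).2 hHρ) one_lt_two
    rw [le_div_iff₀ hρ₀] at hs1
    rw [div_lt_iff₀ hρ₀] at hs2
    refine Set.mem_iUnion.2 ⟨s, H, hH, hs2.le, lt_of_le_of_lt ?_ hlt⟩
    rw [le_div_iff₀ hρ₀]
    calc _ = 128 * (m + 1) * Real.sqrt (DoF d r) * (2 ^ s * ρ₀) ^ 2 := by ring
      _ ≤ _ := by gcongr
  calc _ ≤ P (⋃ s, B s) := measure_mono hsub
    _ ≤ ∑' s, P (B s) := measure_iUnion_le _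
    _ ≤ ∑' s : ℕ, ENNReal.ofReal (Real.exp (-(DoF d r : ℝ)) * (1 / 2) ^ s) :=
        ENNReal.tsum_le_tsum hB
    _ = ENNReal.ofReal (∑' s : ℕ, Real.exp (-(DoF d r : ℝ)) * (1 / 2) ^ s) := by
        rw [ENNReal.ofReal_tsum_of_nonneg (fun j => by positivity)]
        exact (summable_geometric_of_lt_one (by norm_num) (by norm_num)).mul_left _
    _ = _ := by rw [tsum_mul_left, tsum_geometric_two, mul_comm]

lemma two_mul_DoF_le (hm : 1 ≤ m) (d r : Fin m → ℕ) :
    2 * DoF d r ≤ DoF d fun k => 2 * r k := by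
  have h2 : 2 ≤ 2 ^ m := by simpa using Nat.pow_le_pow_right (by norm_num : 0 < 2) hm
  simp only [DoF, Finset.prod_mul_distrib, Finset.prod_const, Finset.card_univ, Fintype.card_fin,
    mul_add, Finset.mul_sum]
  have e : ∀ k, d k * (2 * r k) = 2 * (d k * r k) := fun k => by ring
  simp only [e]
  gcongr

lemma DoF_two_mul_le (hm : 1 ≤ m) (d r : Fin m → ℕ) :
    DoF d (fun k => 2 * r k) ≤ 2 ^ m * DoF d r := by
  have h2 : 2 ≤ 2 ^ m := by simpa using Nat.pow_le_pow_right (by norm_num : 0 < 2) hm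
  simp only [DoF, Finset.prod_mul_distrib, Finset.prod_const, Finset.card_univ, Fintype.card_fin,
    mul_add, Finset.mul_sum]
  have e : ∀ k, d k * (2 * r k) = 2 * (d k * r k) := fun k => by ring
  simp only [e]
  gcongr

/-- The sum `∑ i, ψ (T i) (ξ i)`, centred at its expectation. -/
noncomputable def centeredSum (P : Measure Ω) (ψ : ℝ → ℝ → ℝ) (ξ : MultiIndex d → Ω → ℝ)
    (T : Tensor d) (ω : Ω) : ℝ :=
  ∑ i, (ψ (T i) (ξ i ω) - ∫ ω', ψ (T i) (ξ i ω') ∂P)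

/-- Functions `ψ t`, indexed by a real parameter on which they depend in a `1`-Lipschitz way, with
`ψ 0 = 0`. -/
structure IsContractionFamily (ψ : ℝ → ℝ → ℝ) : Prop where
  measurable : ∀ t, Measurable (ψ t)
  zero : ∀ x, ψ 0 x = 0
  abs_sub_le : ∀ s t x, |ψ s x - ψ t x| ≤ |s - t|

section CenteredSum

variable {P : Measure Ω} [IsProbabilityMeasure P] {ψ : ℝ → ℝ → ℝ} {ξ : MultiIndex d → Ω → ℝ}

lemma IsContractionFamily.integrable (hψ : IsContractionFamily ψ) {X : Ω → ℝ}
    (hX : Measurable X) (t : ℝ) : Integrable (fun ω => ψ t (X ω)) P := by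
  refine Integrable.of_bound ((hψ.measurable t).comp hX).aestronglyMeasurable |t|
    (ae_of_all _ fun ω => ?_)
  simpa [hψ.zero] using hψ.abs_sub_le t 0 (X ω)

lemma continuous_centeredSum (hψ : IsContractionFamily ψ) (hξ : ∀ i, Measurable (ξ i)) (ω : Ω) :
    Continuous fun T : Tensor d => centeredSum P ψ ξ T ω := by
  refine continuous_finsetSum _ fun i _ => ?_
  have h1 : Continuous fun t => ψ t (ξ i ω) :=
    (LipschitzWith.of_dist_le_mul (K := 1) fun s t => by
      simpa [Real.dist_eq] using hψ.abs_sub_le s t (ξ i ω)).continuous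
  have h2 : Continuous fun t => ∫ ω', ψ t (ξ i ω') ∂P :=
    (LipschitzWith.of_dist_le_mul (K := 1) fun s t => by
      rw [Real.dist_eq, Real.dist_eq, NNReal.coe_one, one_mul,
        ← integral_sub (hψ.integrable (hξ i) s) (hψ.integrable (hξ i) t)]
      have := norm_integral_le_of_norm_le_const (μ := P) (C := |s - t|)
        (f := fun ω' => ψ s (ξ i ω') - ψ t (ξ i ω'))
        (ae_of_all _ fun ω' => hψ.abs_sub_le s t (ξ i ω'))
      simpa using this).continuous
  have h3 : Continuous fun T : Tensor d => T i := by fun_prop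
  exact (h1.comp h3).sub (h2.comp h3)

/-- Hoeffding's inequality for the increments of a centred sum of contractions. -/
lemma subGaussianIncrements_centeredSum (hψ : IsContractionFamily ψ)
    (hξ : ∀ i, Measurable (ξ i)) (hind : iIndepFun ξ P) :
    SubGaussianIncrements P (centeredSum (d := d) P ψ ξ) := by
  intro S T t ht
  by_cases hST : S = T
  · subst hST
    have : {ω | t * ‖S - S‖ < |centeredSum P ψ ξ S ω - centeredSum P ψ ξ S ω|} = ∅ := by
      ext ω; simp
    rw [this, measure_empty]; exact zero_le
  let Y : MultiIndex d → Ω → ℝ := fun i ω => (fun x => ψ (S i) x - ψ (T i) x) (ξ i ω)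
  have hgm : ∀ i, Measurable fun x => ψ (S i) x - ψ (T i) x :=
    fun i => (hψ.measurable _).sub (hψ.measurable _)
  have hYm : ∀ i, Measurable (Y i) := fun i => (hgm i).comp (hξ i)
  have hYind : iIndepFun (fun i ω => Y i ω - ∫ ω', Y i ω' ∂P) P :=
    hind.comp (fun i x => ψ (S i) x - ψ (T i) x - ∫ ω', Y i ω' ∂P)
      fun i => (hgm i).sub_const _
  have hYsub : ∀ i ∈ Finset.univ, HasSubgaussianMGF (fun ω => Y i ω - ∫ ω', Y i ω' ∂P)
      ((‖|S i - T i| - (-|S i - T i|)‖₊ / 2) ^ 2) P := fun i _ =>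
    hasSubgaussianMGF_of_mem_Icc (hYm i).aemeasurable
      (ae_of_all _ fun ω => abs_le.1 (hψ.abs_sub_le (S i) (T i) (ξ i ω)))
  have hsum := HasSubgaussianMGF.sum_of_iIndepFun hYind hYsub
  have hc : ((∑ i, (‖|S i - T i| - (-|S i - T i|)‖₊ / 2) ^ 2 : NNReal) : ℝ) = ‖S - T‖ ^ 2 := by
    rw [EuclideanSpace.real_norm_sq_eq, NNReal.coe_sum]
    refine Finset.sum_congr rfl fun i _ => ?_
    rw [NNReal.coe_pow, NNReal.coe_div, coe_nnnorm, Real.norm_eq_abs]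
    have : |(|S i - T i| - (-|S i - T i|))| = 2 * |S i - T i| := by
      rw [sub_neg_eq_add, ← two_mul, abs_of_nonneg (by positivity)]
    rw [this]
    simp
  have hdiff : ∀ ω, centeredSum P ψ ξ S ω - centeredSum P ψ ξ T ω =
      ∑ i, (Y i ω - ∫ ω', Y i ω' ∂P) := by
    intro ω
    rw [centeredSum, centeredSum, ← Finset.sum_sub_distrib]
    refine Finset.sum_congr rfl fun i _ => ?_
    have : ∫ ω', Y i ω' ∂P = ∫ ω', ψ (S i) (ξ i ω') ∂P - ∫ ω', ψ (T i) (ξ i ω') ∂P :=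
      integral_sub (hψ.integrable (hξ i) _) (hψ.integrable (hξ i) _)
    rw [this]
    simp only [Y]; ring
  have hpos : 0 < ‖S - T‖ := norm_pos_iff.2 (sub_ne_zero.2 hST)
  have hε : 0 ≤ t * ‖S - T‖ := by positivity
  have hexp : Real.exp (-(t * ‖S - T‖) ^ 2 / (2 * ‖S - T‖ ^ 2)) = Real.exp (-t ^ 2 / 2) := by
    congr 1; field_simp
  have h1 := hsum.measure_ge_le hε
  have h2 := hsum.neg.measure_ge_le hε
  rw [hc, hexp] at h1 h2
  have hcover : {ω | t * ‖S - T‖ < |centeredSum P ψ ξ S ω - centeredSum P ψ ξ T ω|} ⊆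
      {ω | t * ‖S - T‖ ≤ ∑ i, (Y i ω - ∫ ω', Y i ω' ∂P)} ∪
      {ω | t * ‖S - T‖ ≤ (-fun ω => ∑ i, (Y i ω - ∫ ω', Y i ω' ∂P)) ω} := by
    intro ω hω
    rw [Set.mem_ofPred_eq, hdiff, lt_abs] at hω
    exact hω.imp (fun h => h.le) (fun h => h.le)
  calc _ ≤ P _ + P _ := (measure_mono hcover).trans (measure_union_le _ _)
    _ ≤ ENNReal.ofReal (Real.exp (-t ^ 2 / 2)) + ENNReal.ofReal (Real.exp (-t ^ 2 / 2)) := by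
        gcongr
        · rw [← ofReal_measureReal]; exact ENNReal.ofReal_le_ofReal h1
        · rw [← ofReal_measureReal]; exact ENNReal.ofReal_le_ofReal h2
    _ = _ := by rw [← ENNReal.ofReal_add (by positivity) (by positivity), two_mul]

end CenteredSum

end LowRankProcess

/-! ### The pseudo-Huber function -/

section Huber

/-- The derivative `x / √(x² + δ²)` of the pseudo-Huber function. -/
noncomputable def huberDeriv (δ x : ℝ) : ℝ := x / Real.sqrt (x ^ 2 + δ ^ 2)

lemma abs_le_huber (δ x : ℝ) : |x| ≤ Real.sqrt (x ^ 2 + δ ^ 2) :=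
  Real.abs_le_sqrt (by nlinarith [sq_nonneg δ])

lemma huber_le_abs_add {δ : ℝ} (hδ : 0 ≤ δ) (x : ℝ) : Real.sqrt (x ^ 2 + δ ^ 2) ≤ |x| + δ := by
  refine Real.sqrt_le_iff.2 ⟨by positivity, ?_⟩
  nlinarith [abs_nonneg x, sq_abs x, mul_nonneg (abs_nonneg x) hδ]

lemma huber_pos {δ : ℝ} (hδ : 0 < δ) (x : ℝ) : 0 < Real.sqrt (x ^ 2 + δ ^ 2) :=
  Real.sqrt_pos.2 (by positivity)

lemma abs_huber_sub_le {δ : ℝ} (hδ : 0 < δ) (x y : ℝ) :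
    |Real.sqrt (x ^ 2 + δ ^ 2) - Real.sqrt (y ^ 2 + δ ^ 2)| ≤ |x - y| := by
  set a := Real.sqrt (x ^ 2 + δ ^ 2)
  set b := Real.sqrt (y ^ 2 + δ ^ 2)
  have ha : 0 < a := huber_pos hδ x
  have hb : 0 < b := huber_pos hδ y
  have ha2 : a ^ 2 = x ^ 2 + δ ^ 2 := Real.sq_sqrt (by positivity)
  have hb2 : b ^ 2 = y ^ 2 + δ ^ 2 := Real.sq_sqrt (by positivity)
  have h : |a - b| * (a + b) = |x - y| * |x + y| := by
    calc |a - b| * (a + b) = |a - b| * |a + b| := by rw [abs_of_pos (add_pos ha hb)]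
      _ = |(x - y) * (x + y)| := by
          rw [← abs_mul]
          congr 1
          linear_combination ha2 - hb2
      _ = _ := abs_mul _ _
  have h2 : |x + y| ≤ a + b :=
    (abs_add_le x y).trans (add_le_add (abs_le_huber δ x) (abs_le_huber δ y))
  refine le_of_mul_le_mul_right ?_ (add_pos ha hb)
  rw [h]; gcongr

lemma hasDerivAt_huber {δ : ℝ} (hδ : 0 < δ) (x : ℝ) :
    HasDerivAt (fun x => Real.sqrt (x ^ 2 + δ ^ 2)) (huberDeriv δ x) x := by
  have h : HasDerivAt (fun x : ℝ => x ^ 2 + δ ^ 2) (2 * x) x := by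
    simpa using (hasDerivAt_pow 2 x).add_const (δ ^ 2)
  have := h.sqrt (by positivity)
  convert! this using 1
  rw [huberDeriv, mul_div_mul_left _ _ two_ne_zero]

lemma abs_huberDeriv_le_one {δ : ℝ} (hδ : 0 < δ) (x : ℝ) : |huberDeriv δ x| ≤ 1 := by
  rw [huberDeriv, abs_div, abs_of_pos (huber_pos hδ x)]
  exact (div_le_one (huber_pos hδ x)).2 (abs_le_huber δ x)

lemma huberDeriv_neg (δ x : ℝ) : huberDeriv δ (-x) = -huberDeriv δ x := by
  rw [huberDeriv, huberDeriv, neg_sq, neg_div]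

lemma continuous_huberDeriv {δ : ℝ} (hδ : 0 < δ) : Continuous (huberDeriv δ) := by
  unfold huberDeriv
  exact continuous_id.div (by fun_prop) fun x => (huber_pos hδ x).ne'

lemma abs_huberDeriv_sub_le {δ : ℝ} (hδ : 0 < δ) (x y : ℝ) :
    |huberDeriv δ x - huberDeriv δ y| ≤ δ⁻¹ * |x - y| := by
  have hder : ∀ x ∈ (Set.univ : Set ℝ), HasDerivWithinAt (huberDeriv δ)
      ((1 * Real.sqrt (x ^ 2 + δ ^ 2) - x * huberDeriv δ x) / Real.sqrt (x ^ 2 + δ ^ 2) ^ 2)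
      Set.univ x := fun x _ =>
    ((hasDerivAt_id x).div (hasDerivAt_huber hδ x) (huber_pos hδ x).ne').hasDerivWithinAt
  refine Convex.norm_image_sub_le_of_norm_hasDerivWithin_le (C := δ⁻¹) hder (fun z _ => ?_)
    convex_univ (Set.mem_univ y) (Set.mem_univ x)
  have hs := huber_pos hδ z
  have hs2 : Real.sqrt (z ^ 2 + δ ^ 2) ^ 2 = z ^ 2 + δ ^ 2 := Real.sq_sqrt (by positivity)
  have hsδ : δ ≤ Real.sqrt (z ^ 2 + δ ^ 2) := Real.le_sqrt_of_sq_le (by nlinarith [sq_nonneg z])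
  rw [huberDeriv]
  set s := Real.sqrt (z ^ 2 + δ ^ 2)
  have e : (1 * s - z * (z / s)) / s ^ 2 = δ ^ 2 / s ^ 3 := by
    field_simp
    linarith
  rw [e, Real.norm_of_nonneg (by positivity), inv_eq_one_div, div_le_div_iff₀ (by positivity) hδ,
    one_mul, ← pow_succ]
  gcongr

lemma inv_maxNorm_mul_sum_sq_le {ι : Type*} [Fintype ι] (D : ι → ℝ) :
    (maxNorm D)⁻¹ * ∑ i, D i ^ 2 ≤ ∑ i, |D i| := by
  have hbdd : BddAbove (Set.range fun i => |D i|) := Set.finite_range _ |>.bddAbove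
  have h0 : 0 ≤ maxNorm D := Real.iSup_nonneg fun i => abs_nonneg _
  rcases h0.eq_or_lt with h | h
  · rw [← h]; simpa using Finset.sum_nonneg fun i _ => abs_nonneg (D i)
  · rw [inv_mul_le_iff₀ h, Finset.mul_sum]
    refine Finset.sum_le_sum fun i _ => ?_
    rw [← sq_abs, sq]
    exact mul_le_mul_of_nonneg_right (le_ciSup hbdd i) (abs_nonneg _)

/-- Sharpness of the loss far from the minimum: it grows like the `ℓ₁` norm, up to the size of the
noise `x`. -/
lemma pseudoHuber_sub_ge {ι : Type*} [Fintype ι] {δ : ℝ} (hδ : 0 ≤ δ) (D x : ι → ℝ) :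
    (maxNorm D)⁻¹ * ∑ i, D i ^ 2 - 2 * ∑ i, |x i| - Fintype.card ι * δ ≤
      pseudoHuber δ (fun i => D i - x i) - pseudoHuber δ (fun i => -x i) := by
  have h : ∑ i, (|D i| - 2 * |x i| - δ) ≤
      pseudoHuber δ (fun i => D i - x i) - pseudoHuber δ (fun i => -x i) := by
    rw [pseudoHuber, pseudoHuber, ← Finset.sum_sub_distrib]
    refine Finset.sum_le_sum fun i _ => ?_
    have h1 := abs_le_huber δ (D i - x i)
    have h2 := huber_le_abs_add hδ (-x i)
    have h3 := abs_sub_abs_le_abs_sub (D i) (x i)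
    rw [abs_neg] at h2
    linarith
  have h2 := inv_maxNorm_mul_sum_sq_le D
  simp only [Finset.sum_sub_distrib, ← Finset.mul_sum, Finset.sum_const, Finset.card_univ,
    nsmul_eq_mul] at h
  linarith

variable {m : ℕ} {d : Fin m → ℕ}

/-- The loss is differentiable, so that its only subgradient is the gradient. -/
lemma IsSubgradient.apply_eq {δ : ℝ} (hδ : 0 < δ) {Y T G : Tensor d}
    (h : IsSubgradient (huberObj δ Y) T G) (i : MultiIndex d) :
    G i = huberDeriv δ (T i - Y i) := by
  have key : ∀ s : ℝ, Real.sqrt ((T i - Y i) ^ 2 + δ ^ 2) ≤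
      Real.sqrt ((T i - Y i + s) ^ 2 + δ ^ 2) - s * G i := by
    intro s
    have h1 := h (T + EuclideanSpace.single i s)
    rw [add_sub_cancel_left, EuclideanSpace.inner_single_right] at h1
    simp only [conj_trivial] at h1
    have h2 : huberObj δ Y (T + EuclideanSpace.single i s) - huberObj δ Y T =
        Real.sqrt ((T i - Y i + s) ^ 2 + δ ^ 2) - Real.sqrt ((T i - Y i) ^ 2 + δ ^ 2) := by
      rw [huberObj, huberObj, pseudoHuber, pseudoHuber, ← Finset.sum_sub_distrib,
        Finset.sum_eq_single i]
      · simp only [PiLp.sub_apply, PiLp.add_apply, PiLp.single_apply, if_true]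
        ring_nf
      · intro j _ hj
        simp [hj]
      · simp
    linarith
  have hmin : IsLocalMin (fun s => Real.sqrt ((T i - Y i + s) ^ 2 + δ ^ 2) - s * G i) 0 :=
    Filter.Eventually.of_forall fun s => by simpa using key s
  have hd : HasDerivAt (fun s => Real.sqrt ((T i - Y i + s) ^ 2 + δ ^ 2) - s * G i)
      (huberDeriv δ (T i - Y i) - G i) 0 := by
    have h1 : HasDerivAt (fun s => Real.sqrt ((T i - Y i + s) ^ 2 + δ ^ 2))
        (huberDeriv δ (T i - Y i)) 0 := by
      have := HasDerivAt.comp_const_add (T i - Y i) (0 : ℝ)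
        (f := fun x => Real.sqrt (x ^ 2 + δ ^ 2)) (by rw [add_zero]; exact hasDerivAt_huber hδ _)
      exact this
    have h2 := h1.sub ((hasDerivAt_id (0 : ℝ)).mul_const (G i))
    rw [one_mul] at h2
    exact h2
  have := hmin.hasDerivAt_eq_zero hd
  linarith

lemma card_multiIndex (d : Fin m → ℕ) : Fintype.card (MultiIndex d) = dStar d := by
  simp [Fintype.card_pi, dStar]

lemma card_otherIndex (d : Fin m → ℕ) (k : Fin m) :
    Fintype.card (∀ j : {j : Fin m // j ≠ k}, Fin (d j)) = dMinus d k := by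
  rw [Fintype.card_pi, dMinus]
  simp only [Fintype.card_fin]
  exact (Finset.prod_subtype _ (by simp) _).symm

lemma dStar_eq_mul (d : Fin m → ℕ) (k : Fin m) : dStar d = d k * dMinus d k :=
  (Finset.mul_prod_erase _ _ (Finset.mem_univ k)).symm

lemma norm_le_sqrt_dStar {G : Tensor d} (hG : ∀ i, |G i| ≤ 1) : ‖G‖ ≤ Real.sqrt (dStar d) := by
  refine Real.le_sqrt_of_sq_le ?_
  rw [EuclideanSpace.real_norm_sq_eq, ← card_multiIndex]
  calc ∑ i, G i ^ 2 ≤ ∑ _i : MultiIndex d, (1 : ℝ) :=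
        Finset.sum_le_sum fun i _ => (sq_le_one_iff_abs_le_one _).2 (hG i)
    _ = _ := by simp

end Huber

/-! ### Tangent spaces -/

section Tangent

variable {m : ℕ} {d r : Fin m → ℕ}

lemma tuckerProd_update_one_comp (k : Fin m) (C : Tensor r)
    (U : ∀ k, Matrix (Fin (d k)) (Fin (r k)) ℝ) (Q : Matrix (Fin (d k)) (Fin (d k)) ℝ) :
    tuckerProd (tuckerProd C U) (Function.update (fun _ => 1) k Q) =
      tuckerProd C (Function.update U k (Q * U k)) := by
  apply matricize_injective k
  rw [matricize_modeProd, matricize_tuckerProd, matricize_tuckerProd_update, Matrix.mul_assoc]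

lemma tuckerProd_comp_update_one (k : Fin m) (C : Tensor r)
    (U : ∀ k, Matrix (Fin (d k)) (Fin (r k)) ℝ) (A : Matrix (Fin (r k)) (Fin (r k)) ℝ) :
    tuckerProd (tuckerProd C (Function.update (fun _ => 1) k A)) U =
      tuckerProd C (Function.update U k (U k * A)) := by
  rw [tuckerProd_tuckerProd]
  congr 1
  funext j
  by_cases hj : j = k
  · subst hj; simp
  · simp [hj]

lemma tuckerProd_update_zero (k : Fin m) (C : Tensor r)
    (U : ∀ k, Matrix (Fin (d k)) (Fin (r k)) ℝ) :
    tuckerProd C (Function.update U k 0) = 0 := by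
  apply matricize_injective k
  rw [matricize_tuckerProd_update, Matrix.zero_mul]; rfl

lemma one_sub_mul_transpose_mul_self {a b : ℕ} {W : Matrix (Fin a) (Fin b) ℝ}
    (h : W.transpose * W = 1) : (1 - W * W.transpose) * W = 0 := by
  rw [Matrix.sub_mul, Matrix.mul_assoc, h]; simp

/-- Every tangent vector is a sum `D · ⟦U⟧ + ∑ k, C · ⟦U₁, …, V_k, …, Uₘ⟧` in which the factors
`V_k` are orthogonal to `U_k`: the `k`-th summand is recovered by mode-`k` multiplication with the
projection `1 - U_k U_kᵀ`. -/
lemma mem_tuckerTangent_decomp {C : Tensor r} {U : ∀ k, Matrix (Fin (d k)) (Fin (r k)) ℝ}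
    (hU : ∀ k, (U k).transpose * U k = 1) {H : Tensor d} (hH : H ∈ tuckerTangent C U) :
    (∀ k, ∃ V : Matrix (Fin (d k)) (Fin (r k)) ℝ,
      tuckerProd H (Function.update (fun _ => 1) k (1 - U k * (U k).transpose)) =
        tuckerProd C (Function.update U k V)) ∧
    ∃ D : Tensor r,
      H - ∑ k, tuckerProd H (Function.update (fun _ => 1) k (1 - U k * (U k).transpose)) =
        tuckerProd D U := by
  induction hH using Submodule.span_induction with
  | mem H hH =>
    rcases hH with ⟨D, rfl⟩ | ⟨k, V, rfl⟩
    · have h0 : ∀ k, tuckerProd (tuckerProd D U)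
          (Function.update (fun _ => 1) k (1 - U k * (U k).transpose)) = 0 := fun k => by
        rw [tuckerProd_update_one_comp, one_sub_mul_transpose_mul_self (hU k),
          tuckerProd_update_zero]
      refine ⟨fun k => ⟨0, by rw [h0, tuckerProd_update_zero]⟩, D, ?_⟩
      simp [h0]
    · have h0 : ∀ j, j ≠ k → tuckerProd (tuckerProd C (Function.update U k V))
          (Function.update (fun _ => 1) j (1 - U j * (U j).transpose)) = 0 := fun j hj => by
        rw [tuckerProd_update_one_comp, Function.update_of_ne hj,
          one_sub_mul_transpose_mul_self (hU j), tuckerProd_update_zero]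
      have hk : tuckerProd (tuckerProd C (Function.update U k V))
          (Function.update (fun _ => 1) k (1 - U k * (U k).transpose)) =
          tuckerProd C (Function.update U k ((1 - U k * (U k).transpose) * V)) := by
        rw [tuckerProd_update_one_comp, Function.update_self, Function.update_idem]
      refine ⟨fun j => ?_, tuckerProd C (Function.update (fun _ => 1) k ((U k).transpose * V)), ?_⟩
      · by_cases hj : j = k
        · subst hj; exact ⟨_, hk⟩
        · exact ⟨0, by rw [h0 j hj, tuckerProd_update_zero]⟩
      · rw [Finset.sum_eq_single k (fun j _ hj => h0 j hj) (by simp), hk,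
          tuckerProd_comp_update_one]
        apply matricize_injective k
        rw [matricize_sub]
        simp only [matricize_tuckerProd_update]
        rw [← Matrix.sub_mul, ← Matrix.mul_assoc]
        congr 1
        rw [Matrix.sub_mul]; simp
  | zero =>
    refine ⟨fun k => ⟨0, ?_⟩, 0, ?_⟩
    · rw [tuckerProd_zero_left, tuckerProd_update_zero]
    · simp [tuckerProd_zero_left]
  | add H₁ H₂ _ _ h₁ h₂ =>
    obtain ⟨h₁, D₁, hD₁⟩ := h₁
    obtain ⟨h₂, D₂, hD₂⟩ := h₂
    refine ⟨fun k => ?_, D₁ + D₂, ?_⟩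
    · obtain ⟨V₁, hV₁⟩ := h₁ k
      obtain ⟨V₂, hV₂⟩ := h₂ k
      refine ⟨V₁ + V₂, ?_⟩
      rw [tuckerProd_add_left, hV₁, hV₂]
      exact ((tuckerMultilinear C).map_update_add U k V₁ V₂).symm
    · rw [tuckerProd_add_left, ← hD₁, ← hD₂]
      simp only [tuckerProd_add_left, Finset.sum_add_distrib]
      abel
  | smul c H _ h =>
    obtain ⟨h, D, hD⟩ := h
    refine ⟨fun k => ?_, c • D, ?_⟩
    · obtain ⟨V, hV⟩ := h k
      refine ⟨c • V, ?_⟩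
      rw [tuckerProd_smul_left, hV]
      exact ((tuckerMultilinear C).map_update_smul U k c V).symm
    · rw [tuckerProd_smul_left, ← hD]
      simp only [tuckerProd_smul_left, ← Finset.smul_sum, smul_sub]

open scoped Matrix.Norms.L2Operator in
/-- The projection of `G` to a tangent space is controlled by the pairing of `G` with tensors of low
rank, because each of the `m + 1` parts of a tangent vector has low rank. -/
lemma norm_starProjection_tangent_le {T : Tensor d} {𝕋 : Submodule ℝ (Tensor d)}
    (h𝕋 : IsTangentSpace r T 𝕋) {G : Tensor d} {a : ℝ} (ha : 0 ≤ a)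
    (hG : ∀ H ∈ tuckerRankLE d r, |inner ℝ G H| ≤ a * ‖H‖) :
    ‖𝕋.starProjection G‖ ≤ (2 * m + 1) * a := by
  obtain ⟨C, U, ⟨hU, -⟩, rfl⟩ := h𝕋
  set H := (tuckerTangent C U).starProjection G
  have hH : H ∈ tuckerTangent C U := Submodule.starProjection_apply_mem _ _
  obtain ⟨hV, D, hD⟩ := mem_tuckerTangent_decomp hU hH
  set Hk : Fin m → Tensor d := fun k =>
    tuckerProd H (Function.update (fun _ => 1) k (1 - U k * (U k).transpose))
  have hHk : ∀ k, ‖Hk k‖ ≤ ‖H‖ := fun k =>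
    (norm_modeProd_le _ _ _).trans
      (mul_le_of_le_one_left (norm_nonneg _) (norm_one_sub_mul_transpose_le (hU k)))
  have h1 : ∀ k, |inner ℝ G (Hk k)| ≤ a * ‖H‖ := fun k => by
    obtain ⟨V, hV⟩ := hV k
    refine (hG (Hk k) ?_).trans (by gcongr; exact hHk k)
    rw [show Hk k = _ from hV]
    exact tuckerProd_mem_tuckerRankLE _ _
  have h2 : |inner ℝ G (H - ∑ k, Hk k)| ≤ a * ((m + 1) * ‖H‖) := by
    refine (hG _ ?_).trans ?_
    · rw [hD]; exact tuckerProd_mem_tuckerRankLE _ _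
    · gcongr
      calc ‖H - ∑ k, Hk k‖ ≤ ‖H‖ + ∑ k, ‖Hk k‖ :=
            (norm_sub_le _ _).trans (by gcongr; exact norm_sum_le _ _)
        _ ≤ ‖H‖ + ∑ _k : Fin m, ‖H‖ := by gcongr with k; exact hHk k
        _ = _ := by simp; ring
  have h3 : ‖H‖ ^ 2 = inner ℝ G H := by
    have := Submodule.starProjection_inner_eq_zero (K := tuckerTangent C U) G H hH
    rw [inner_sub_left, real_inner_self_eq_norm_sq] at this
    linarith
  have h4 : inner ℝ G H = inner ℝ G (H - ∑ k, Hk k) + ∑ k, inner ℝ G (Hk k) := by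
    rw [← inner_sum, ← inner_add_right, sub_add_cancel]
  have h5 : ‖H‖ ^ 2 ≤ (2 * m + 1) * a * ‖H‖ := by
    rw [h3, h4]
    calc _ ≤ a * ((m + 1) * ‖H‖) + ∑ _k : Fin m, a * ‖H‖ :=
          add_le_add ((le_abs_self _).trans h2)
            (Finset.sum_le_sum fun k _ => (le_abs_self _).trans (h1 k))
      _ = _ := by simp; ring
  rcases (norm_nonneg H).eq_or_lt with h0 | h0
  · rw [← h0]; positivity
  · rw [sq] at h5; exact le_of_mul_le_mul_right h5 h0

/-- Two orthonormal bases of the column space of a matrix give the same projection. -/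
lemma mul_transpose_eq_of_rank_eq {a b : ℕ} {ι : Type*} [Fintype ι]
    {U W : Matrix (Fin a) (Fin b) ℝ} (hU : U.transpose * U = 1) (hW : W.transpose * W = 1)
    {A B : Matrix (Fin b) ι ℝ} (hAB : U * A = W * B) (hr : (U * A).rank = b) :
    U * U.transpose = W * W.transpose := by
  have hrange : ∀ {U : Matrix (Fin a) (Fin b) ℝ} {A : Matrix (Fin b) ι ℝ}, (U * A).rank = b →
      LinearMap.range (U * A).mulVecLin = LinearMap.range U.mulVecLin := by
    intro U A h
    refine Submodule.eq_of_le_of_finrank_le ?_ ?_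
    · rw [Matrix.mulVecLin_mul]; exact LinearMap.range_comp_le_range _ _
    · exact (Matrix.rank_le_width U).trans h.ge
  have hUW : LinearMap.range U.mulVecLin = LinearMap.range W.mulVecLin := by
    rw [← hrange hr, hAB, hrange (hAB ▸ hr)]
  have key : ∀ {U W : Matrix (Fin a) (Fin b) ℝ}, U.transpose * U = 1 →
      LinearMap.range W.mulVecLin ≤ LinearMap.range U.mulVecLin → U * U.transpose * W = W := by
    intro U W hU h
    apply Matrix.ext_of_mulVec_single
    intro i
    obtain ⟨z, hz⟩ := h ⟨Pi.single i 1, rfl⟩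
    simp only [Matrix.mulVecLin_apply] at hz
    rw [← Matrix.mulVec_mulVec, ← hz, Matrix.mulVec_mulVec, Matrix.mul_assoc, hU, Matrix.mul_one]
  have h1 : U * U.transpose * (W * W.transpose) = W * W.transpose := by
    rw [← Matrix.mul_assoc, key hU hUW.ge]
  have h2 : W * W.transpose * (U * U.transpose) = U * U.transpose := by
    rw [← Matrix.mul_assoc, key hW hUW.le]
  have h3 := congrArg Matrix.transpose h1
  simp only [Matrix.transpose_mul, Matrix.transpose_transpose] at h3
  exact h2.symm.trans h3

lemma matricize_mem_tuckerTangent (k : Fin m) {C : Tensor r}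
    {U : ∀ k, Matrix (Fin (d k)) (Fin (r k)) ℝ} {H : Tensor d} (hH : H ∈ tuckerTangent C U) :
    ∃ (V : Matrix (Fin (d k)) (Fin (r k)) ℝ)
      (B : Matrix (Fin (r k)) (∀ j : {j : Fin m // j ≠ k}, Fin (d j)) ℝ),
      matricize k H = V * tuckerCofactor k C U + U k * B := by
  induction hH using Submodule.span_induction with
  | mem H hH =>
    rcases hH with ⟨D, rfl⟩ | ⟨j, V, rfl⟩
    · exact ⟨0, _, by rw [matricize_tuckerProd, Matrix.zero_mul, zero_add]⟩
    · by_cases hj : j = k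
      · subst hj
        exact ⟨V, 0, by rw [matricize_tuckerProd_update, Matrix.mul_zero, add_zero]⟩
      · refine ⟨0, tuckerCofactor k C (Function.update U j V), ?_⟩
        rw [matricize_tuckerProd, Function.update_of_ne (Ne.symm hj), Matrix.zero_mul, zero_add]
  | zero => exact ⟨0, 0, by simp; rfl⟩
  | add H₁ H₂ _ _ h₁ h₂ =>
    obtain ⟨V₁, B₁, h₁⟩ := h₁
    obtain ⟨V₂, B₂, h₂⟩ := h₂
    exact ⟨V₁ + V₂, B₁ + B₂, by
      rw [matricize_add, h₁, h₂, Matrix.add_mul, Matrix.mul_add]; abel⟩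
  | smul c H _ h =>
    obtain ⟨V, B, h⟩ := h
    exact ⟨c • V, c • B, by rw [matricize_smul, h, smul_add, Matrix.smul_mul, Matrix.mul_smul]⟩

lemma sum_sq_mul_of_orthonormal {a b : ℕ} {ι : Type*} [Fintype ι] {U : Matrix (Fin a) (Fin b) ℝ}
    (hU : U.transpose * U = 1) (Y : Matrix (Fin b) ι ℝ) :
    ∑ i, ∑ I, (U * Y) i I ^ 2 = ∑ c, ∑ I, Y c I ^ 2 := by
  have key : ∀ {a : ℕ} (X : Matrix (Fin a) ι ℝ),
      ∑ i, ∑ I, X i I ^ 2 = (X.transpose * X).trace := by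
    intro a X
    rw [Matrix.trace, Finset.sum_comm]
    simp [Matrix.mul_apply, sq]
  rw [key, key, Matrix.transpose_mul, Matrix.mul_assoc, ← Matrix.mul_assoc U.transpose, hU,
    Matrix.one_mul]

/-- A row of the projection of `G` to a tangent space splits orthogonally along the row space of the
matricization of the base point: the part in this space is the projection of the same row of `G`,
and the other part has its columns in the range of `U_k`. -/
lemma sum_sq_row_starProjection_le (k : Fin m) (C : Tensor r)
    {U : ∀ k, Matrix (Fin (d k)) (Fin (r k)) ℝ} (hU : (U k).transpose * U k = 1)
    (G : Tensor d) (j : Fin (d k)) :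
    ∑ I, matricize k ((tuckerTangent C U).starProjection G) j I ^ 2 ≤
      ∑ I, matricize k G j I ^ 2 + (∑ c, U k j c ^ 2) * ‖G‖ ^ 2 := by
  set H := (tuckerTangent C U).starProjection G with hHdef
  have hH : H ∈ tuckerTangent C U := Submodule.starProjection_apply_mem _ _
  obtain ⟨V, B, hVB⟩ := matricize_mem_tuckerTangent k hH
  let row : Matrix (Fin (r k)) (∀ j : {j : Fin m // j ≠ k}, Fin (d j)) ℝ → Fin (r k) →
    EuclideanSpace ℝ (∀ j : {j : Fin m // j ≠ k}, Fin (d j)) := fun B c => WithLp.toLp 2 (B c)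
  let h : Fin (d k) → EuclideanSpace ℝ (∀ j : {j : Fin m // j ≠ k}, Fin (d j)) :=
    fun i => WithLp.toLp 2 (matricize k H i)
  let g : EuclideanSpace ℝ (∀ j : {j : Fin m // j ≠ k}, Fin (d j)) :=
    WithLp.toLp 2 (matricize k G j)
  set K := Submodule.span ℝ (Set.range (row (tuckerCofactor k C U)))
  have hrowsum : ∀ (A : Matrix (Fin (d k)) (Fin (r k)) ℝ)
      (B : Matrix (Fin (r k)) (∀ j : {j : Fin m // j ≠ k}, Fin (d j)) ℝ) (i : Fin (d k)),
      WithLp.toLp 2 ((A * B) i) = ∑ c, A i c • row B c := by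
    intro A B i
    ext I
    simp [Matrix.mul_apply, row]
  have hsplit : ∀ i, h i = ∑ c, V i c • row (tuckerCofactor k C U) c + ∑ c, U k i c • row B c := by
    intro i
    rw [← hrowsum, ← hrowsum]
    simp only [h, hVB]
    rfl
  -- the rows `x i` of the component orthogonal to `K`
  let y : Fin (r k) → EuclideanSpace ℝ (∀ j : {j : Fin m // j ≠ k}, Fin (d j)) :=
    fun c => Kᗮ.starProjection (row B c)
  have hx : ∀ i, Kᗮ.starProjection (h i) = ∑ c, U k i c • y c := by
    intro i
    rw [hsplit, map_add]
    have h0 : Kᗮ.starProjection (∑ c, V i c • row (tuckerCofactor k C U) c) = 0 := by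
      rw [Submodule.starProjection_apply_eq_zero_iff, Submodule.orthogonal_orthogonal]
      exact Submodule.sum_mem _ fun c _ =>
        Submodule.smul_mem _ _ (Submodule.subset_span ⟨c, rfl⟩)
    rw [h0, zero_add, map_sum]
    simp only [map_smul, y]
  let Y : Matrix (Fin (r k)) (∀ j : {j : Fin m // j ≠ k}, Fin (d j)) ℝ := fun c I => y c I
  have hxY : ∀ i I, (U k * Y) i I = Kᗮ.starProjection (h i) I := by
    intro i I
    rw [hx, Matrix.mul_apply]
    simp [Y]
  have hHnorm : ‖H‖ ≤ ‖G‖ := Submodule.norm_starProjection_apply_le _ _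
  have hYnorm : ∑ c, ∑ I, Y c I ^ 2 ≤ ‖G‖ ^ 2 := by
    rw [← sum_sq_mul_of_orthonormal hU Y]
    calc ∑ i, ∑ I, (U k * Y) i I ^ 2 = ∑ i, ‖Kᗮ.starProjection (h i)‖ ^ 2 := by
          simp only [hxY, EuclideanSpace.real_norm_sq_eq]
      _ ≤ ∑ i, ‖h i‖ ^ 2 := by
          gcongr with i; exact Submodule.norm_starProjection_apply_le _ _
      _ = ‖H‖ ^ 2 := by
          rw [norm_sq_eq_sum_matricize k]; simp only [EuclideanSpace.real_norm_sq_eq, h]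
      _ ≤ _ := by gcongr
  have hrow : ‖Kᗮ.starProjection (h j)‖ ^ 2 ≤ (∑ c, U k j c ^ 2) * ‖G‖ ^ 2 := by
    calc ‖Kᗮ.starProjection (h j)‖ ^ 2 = ∑ I, (∑ c, U k j c * Y c I) ^ 2 := by
          rw [EuclideanSpace.real_norm_sq_eq]
          simp only [← hxY, Matrix.mul_apply]
      _ ≤ ∑ I, (∑ c, U k j c ^ 2) * ∑ c, Y c I ^ 2 :=
          Finset.sum_le_sum fun I _ => Finset.sum_mul_sq_le_sq_mul_sq _ _ _
      _ = (∑ c, U k j c ^ 2) * ∑ c, ∑ I, Y c I ^ 2 := by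
          rw [← Finset.mul_sum, Finset.sum_comm]
      _ ≤ _ := by gcongr
  -- the variations of the `j`-th row of `V_k` lie in the tangent space
  have hK : K.starProjection (h j) = K.starProjection g := by
    rw [← sub_eq_zero, ← map_sub, Submodule.starProjection_apply_eq_zero_iff,
      Submodule.mem_orthogonal]
    intro z hz
    induction hz using Submodule.span_induction with
    | mem z hz =>
      obtain ⟨c, rfl⟩ := hz
      have hmem : tuckerProd C (Function.update U k (Matrix.single j c 1)) ∈ tuckerTangent C U :=
        Submodule.subset_span (Or.inr ⟨k, _, rfl⟩)
      have h0 := Submodule.starProjection_inner_eq_zero (K := tuckerTangent C U) G _ hmem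
      rw [← hHdef, inner_eq_sum_matricize k, matricize_tuckerProd_update, matricize_sub,
        Finset.sum_eq_single j] at h0
      · have e : ∀ I, (Matrix.single j c (1 : ℝ) * tuckerCofactor k C U) j I =
            tuckerCofactor k C U c I := fun I => by simp
        simp only [e, Matrix.sub_apply] at h0
        simp only [PiLp.inner_apply, RCLike.inner_apply, conj_trivial, PiLp.sub_apply]
        rw [← neg_eq_zero, ← h0, ← Finset.sum_neg_distrib]
        refine Finset.sum_congr rfl fun I _ => ?_
        simp only [h, g, row]; ring
      · intro i _ hi
        refine Finset.sum_eq_zero fun I _ => ?_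
        rw [Matrix.single_mul_apply_of_ne _ _ _ _ _ hi, mul_zero]
      · simp
    | zero => simp
    | add z w _ _ hz hw => rw [inner_add_left, hz, hw, add_zero]
    | smul c z _ hz => rw [inner_smul_left, hz, mul_zero]
  calc ∑ I, matricize k H j I ^ 2 = ‖h j‖ ^ 2 := by
        rw [EuclideanSpace.real_norm_sq_eq]
    _ = ‖K.starProjection (h j)‖ ^ 2 + ‖Kᗮ.starProjection (h j)‖ ^ 2 :=
        Submodule.norm_sq_eq_add_norm_sq_starProjection _ _
    _ ≤ ‖g‖ ^ 2 + (∑ c, U k j c ^ 2) * ‖G‖ ^ 2 := by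
        rw [hK]
        gcongr
        exact Submodule.norm_starProjection_apply_le _ _
    _ = _ := by rw [EuclideanSpace.real_norm_sq_eq]

/-! ### Incoherence -/

lemma l2Norm_sq {ι : Type*} [Fintype ι] (A : ι → ℝ) : l2Norm A ^ 2 = ∑ i, A i ^ 2 :=
  Real.sq_sqrt (Finset.sum_nonneg fun _ _ => sq_nonneg _)

lemma sum_sq_row_eq {a b : ℕ} (U : Matrix (Fin a) (Fin b) ℝ) (j : Fin a) :
    ∑ c, U j c ^ 2 = (U * U.transpose) j j := by
  simp [Matrix.mul_apply, sq]

/-- The row norms of the factors of any decomposition of exact size obey the incoherence bound. -/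
lemma IsIncoherent.sum_sq_row_le {T : Tensor d} {μ : ℝ} (hT : IsIncoherent r μ T) {C : Tensor r}
    {U : ∀ k, Matrix (Fin (d k)) (Fin (r k)) ℝ} (hU : IsTuckerDecomp T C U) (k : Fin m)
    (j : Fin (d k)) : ∑ c, U k j c ^ 2 ≤ max (μ * r k / d k) 0 := by
  obtain ⟨hrank, C', W, hW, hinc⟩ := hT
  have h1 : U k * tuckerCofactor k C U = W k * tuckerCofactor k C' W := by
    rw [← matricize_tuckerProd, ← matricize_tuckerProd, ← hU.2, ← hW.2]
  have h2 : (U k * tuckerCofactor k C U).rank = r k := by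
    rw [← matricize_tuckerProd, ← hU.2]; exact hrank k
  rw [sum_sq_row_eq, mul_transpose_eq_of_rank_eq (hU.1 k) (hW.1 k) h1 h2, ← sum_sq_row_eq,
    ← l2Norm_sq]
  have h3 : l2Norm (W k j) ≤ Real.sqrt (μ * r k / d k) :=
    (le_ciSup (f := fun i => l2Norm (W k i)) (Set.finite_range _).bddAbove j).trans (hinc k)
  calc l2Norm (W k j) ^ 2 ≤ Real.sqrt (μ * r k / d k) ^ 2 := by
        gcongr; exact Real.sqrt_nonneg _
    _ ≤ _ := by
        rcases le_total 0 (μ * r k / d k) with h | h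
        · rw [Real.sq_sqrt h]; exact le_max_left _ _
        · rw [Real.sqrt_eq_zero_of_nonpos h]; simp

lemma IsIncoherent.one_le {T : Tensor d} {μ : ℝ} (hT : IsIncoherent r μ T) (k : Fin m)
    (hr : 1 ≤ r k) : 1 ≤ μ := by
  obtain ⟨-, C, U, hU, -⟩ := id hT
  have hr' : (1 : ℝ) ≤ r k := by exact_mod_cast hr
  have h1 : ∑ j, ∑ c, U k j c ^ 2 = r k := by
    simp only [sum_sq_row_eq]
    change (U k * (U k).transpose).trace = _
    rw [Matrix.trace_mul_comm, hU.1 k, Matrix.trace_one, Fintype.card_fin]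
  have h2 : (r k : ℝ) ≤ d k * max (μ * r k / d k) 0 := by
    calc (r k : ℝ) = ∑ j, ∑ c, U k j c ^ 2 := h1.symm
      _ ≤ ∑ _j : Fin (d k), max (μ * r k / d k) 0 :=
          Finset.sum_le_sum fun j _ => hT.sum_sq_row_le hU k j
      _ = _ := by simp
  have hd : (0 : ℝ) < d k := by
    rcases Nat.eq_zero_or_pos (d k) with h | h
    · rw [h] at h2; simp at h2; linarith
    · exact_mod_cast h
  rcases max_choice (μ * r k / d k) 0 with h | h
  · rw [h, mul_div_cancel₀ _ hd.ne'] at h2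
    by_contra! hc
    nlinarith
  · rw [h] at h2; linarith

lemma IsTuckerDecomp.rank_le_dim {T : Tensor d} {C : Tensor r}
    {U : ∀ k, Matrix (Fin (d k)) (Fin (r k)) ℝ} (hU : IsTuckerDecomp T C U) (k : Fin m) :
    r k ≤ d k := by
  have h := (Matrix.rank_mul_le_right (U k).transpose (U k)).trans (Matrix.rank_le_height (U k))
  rwa [hU.1 k, Matrix.rank_one, Fintype.card_fin] at h

/-- Incoherence spreads the projection of a bounded tensor to the tangent space evenly over the
slices. -/
lemma IsIncoherent.twoInfNorm_starProjection_le {T : Tensor d} {μ : ℝ} (hT : IsIncoherent r μ T)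
    {𝕋 : Submodule ℝ (Tensor d)} (h𝕋 : IsTangentSpace r T 𝕋) {G : Tensor d}
    (hG : ∀ i, |G i| ≤ 1) (k : Fin m) :
    twoInfNorm (matricize k (𝕋.starProjection G)) ≤ Real.sqrt (3 * μ * r k * dMinus d k) := by
  obtain ⟨C, U, hU, rfl⟩ := h𝕋
  refine Real.iSup_le (fun j => ?_) (Real.sqrt_nonneg _)
  rcases Nat.eq_zero_or_pos (r k) with h0 | hr
  · -- a core without entries: the tangent space is trivial
    have hzero : ∀ i I, matricize k ((tuckerTangent C U).starProjection G) i I = 0 := by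
      intro i I
      obtain ⟨V, B, hVB⟩ := matricize_mem_tuckerTangent k
        (Submodule.starProjection_apply_mem (tuckerTangent C U) G)
      have : IsEmpty (Fin (r k)) := by rw [h0]; infer_instance
      rw [hVB]
      simp [Matrix.mul_apply]
    have h1 : l2Norm (matricize k ((tuckerTangent C U).starProjection G) j) = 0 := by
      simp [l2Norm, hzero]
    rw [h1]
    exact Real.sqrt_nonneg _
  · have hμ := hT.one_le k hr
    have hr' : (1 : ℝ) ≤ r k := by exact_mod_cast hr
    have hd : (0 : ℝ) < d k := by exact_mod_cast hr.trans_le (hU.rank_le_dim k)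
    have h1 : ∑ I, matricize k G j I ^ 2 ≤ dMinus d k := by
      calc ∑ I, matricize k G j I ^ 2
          ≤ ∑ _I : (∀ j : {j : Fin m // j ≠ k}, Fin (d j)), (1 : ℝ) :=
            Finset.sum_le_sum fun I _ => (sq_le_one_iff_abs_le_one _).2 (hG _)
        _ = dMinus d k := by rw [← card_otherIndex]; simp
    have h2 : ‖G‖ ^ 2 ≤ d k * dMinus d k := by
      have := pow_le_pow_left₀ (norm_nonneg _) (norm_le_sqrt_dStar hG) 2
      rw [Real.sq_sqrt (by positivity), dStar_eq_mul d k] at this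
      exact_mod_cast this
    have h3 := hT.sum_sq_row_le hU k j
    rw [max_eq_left (by positivity)] at h3
    rw [l2Norm]
    apply Real.sqrt_le_sqrt
    calc ∑ I, matricize k ((tuckerTangent C U).starProjection G) j I ^ 2
        ≤ ∑ I, matricize k G j I ^ 2 + (∑ c, U k j c ^ 2) * ‖G‖ ^ 2 :=
          sum_sq_row_starProjection_le k C (hU.1 k) G j
      _ ≤ dMinus d k + (μ * r k / d k) * (d k * dMinus d k) := by gcongr
      _ = dMinus d k + μ * r k * dMinus d k := by field_simp
      _ ≤ 3 * μ * r k * dMinus d k := by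
          have h4 : 1 ≤ μ * r k := by nlinarith
          have h5 : (0 : ℝ) ≤ dMinus d k := by positivity
          nlinarith

end Tangent

/-! ### Moments of the noise and sums over slices -/

section Noise

/-- Taylor's inequality with a crude remainder. -/
lemma exp_le_one_add_add_sq_mul {t B : ℝ} (ht : 0 ≤ t) (htB : t ≤ B) :
    Real.exp t ≤ 1 + t + t ^ 2 * Real.exp B := by
  have h1 : Real.exp t - 1 ≤ t * Real.exp t := by
    have h := mul_le_mul_of_nonneg_right (Real.add_one_le_exp (-t)) (Real.exp_pos t).le
    rw [← Real.exp_add, neg_add_cancel, Real.exp_zero] at h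
    linarith
  have h2 : t * (Real.exp t - 1) ≤ t * (t * Real.exp B) := by
    gcongr
    exact h1.trans (by gcongr)
  have h3 : Real.exp t - 1 - t ≤ t * (Real.exp t - 1) := by linarith
  nlinarith

lemma noiseScale_rpow {ν : Measure ℝ} {ε : ℝ} (hε : 0 < ε) :
    noiseScale ν ε ^ (2 + ε) = ∫ x, |x| ^ (2 + ε) ∂ν := by
  rw [noiseScale, ← Real.rpow_mul (integral_nonneg fun x => by positivity),
    one_div_mul_cancel (by positivity), Real.rpow_one]

/-- Lower moments are bounded by powers of the scale `γ`. -/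
lemma integrable_and_integral_rpow_le {ν : Measure ℝ} [IsProbabilityMeasure ν] {ε : ℝ}
    (hε : 0 < ε) (hmom : Integrable (fun x : ℝ => |x| ^ (2 + ε)) ν) (hγ : 0 < noiseScale ν ε)
    {q : ℝ} (hq : 0 ≤ q) (hqε : q ≤ 2 + ε) :
    Integrable (fun x : ℝ => |x| ^ q) ν ∧ ∫ x, |x| ^ q ∂ν ≤ noiseScale ν ε ^ q := by
  set γ := noiseScale ν ε
  have hs : 0 < 2 + ε := by positivity
  set θ := q / (2 + ε)
  have hθ0 : 0 ≤ θ := by positivity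
  have hθ1 : θ ≤ 1 := (div_le_one hs).2 hqε
  have hγs : 0 < γ ^ (2 + ε) := Real.rpow_pos_of_pos hγ _
  -- Bernoulli's inequality for `|x| ^ q = γ ^ q * ((|x| / γ) ^ (2 + ε)) ^ θ`
  have hpt : ∀ x : ℝ, |x| ^ q ≤ γ ^ q * (1 + θ * (|x| ^ (2 + ε) / γ ^ (2 + ε) - 1)) := by
    intro x
    have hw : 0 ≤ |x| ^ (2 + ε) / γ ^ (2 + ε) := by positivity
    have h := rpow_one_add_le_one_add_mul_self (s := |x| ^ (2 + ε) / γ ^ (2 + ε) - 1)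
      (by linarith) hθ0 hθ1
    rw [add_sub_cancel, Real.div_rpow (by positivity) hγs.le, ← Real.rpow_mul (abs_nonneg x),
      ← Real.rpow_mul hγ.le, mul_div_cancel₀ _ hs.ne', div_le_iff₀ (by positivity)] at h
    linarith
  have hmid : Integrable (fun x : ℝ => |x| ^ (2 + ε) / γ ^ (2 + ε) - 1) ν :=
    (hmom.div_const _).sub (integrable_const _)
  have hint : Integrable (fun x : ℝ => γ ^ q * (1 + θ * (|x| ^ (2 + ε) / γ ^ (2 + ε) - 1))) ν :=
    ((integrable_const _).add (hmid.const_mul _)).const_mul _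
  have hI : Integrable (fun x : ℝ => |x| ^ q) ν := by
    refine hint.mono' ?_ (ae_of_all _ fun x => ?_)
    · exact (measurable_norm.pow_const q : Measurable fun x : ℝ => |x| ^ q).aestronglyMeasurable
    · rw [Real.norm_of_nonneg (by positivity)]; exact hpt x
  refine ⟨hI, (integral_mono hI hint hpt).trans (le_of_eq ?_)⟩
  rw [integral_const_mul, integral_add (integrable_const _) (hmid.const_mul _), integral_const_mul,
    integral_sub (hmom.div_const _) (integrable_const _), integral_div, ← noiseScale_rpow hε,
    div_self hγs.ne']
  simp

variable {ι Ω : Type*} [MeasurableSpace Ω] {P : Measure Ω} [IsProbabilityMeasure P]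

/-- Chernoff's bound for truncated variables; with truncation at `n γ / 2`, the exponent
`log n / (n γ)` is large enough for the rate `n⁻²`. -/
lemma measure_truncated_sum_ge_le {X : ι → Ω → ℝ} (hX : ∀ i, Measurable (X i))
    (hind : iIndepFun X P) {γ : ℝ} (hγ : 0 < γ) (s : Finset ι) (hs : 1 ≤ s.card)
    (hI1 : ∀ i, Integrable (fun ω => |X i ω|) P) (h1 : ∀ i, ∫ ω, |X i ω| ∂P ≤ γ)
    (hI2 : ∀ i, Integrable (fun ω => X i ω ^ 2) P) (h2 : ∀ i, ∫ ω, X i ω ^ 2 ∂P ≤ γ ^ 2) :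
    P.real {ω | 3 * s.card * γ ≤ ∑ i ∈ s, min |X i ω| (s.card * γ / 2)} ≤
      Real.exp 16 * (s.card : ℝ) ^ (-2 : ℝ) := by
  set n : ℝ := (s.card : ℝ) with hnn
  have hn : 1 ≤ n := by rw [hnn]; exact_mod_cast hs
  have hn0 : 0 < n := by linarith
  set lam := Real.log n / (n * γ)
  have hlam : 0 ≤ lam := div_nonneg (Real.log_nonneg hn) (by positivity)
  have hlamγ : lam * γ = Real.log n / n := by simp only [lam]; field_simp
  let W : ι → Ω → ℝ := fun i => (fun x => min |x| (n * γ / 2)) ∘ X i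
  have hgm : Measurable fun x : ℝ => min |x| (n * γ / 2) := by fun_prop
  have hWm : ∀ i, Measurable (W i) := fun i => hgm.comp (hX i)
  have hWind : iIndepFun W P := hind.comp (fun _ x => min |x| (n * γ / 2)) fun _ => hgm
  have hW0 : ∀ i ω, 0 ≤ W i ω := fun i ω => le_min (abs_nonneg _) (by positivity)
  have hWy : ∀ i ω, W i ω ≤ n * γ / 2 := fun i ω => min_le_right _ _
  have hWX : ∀ i ω, W i ω ≤ |X i ω| := fun i ω => min_le_left _ _
  have hlamy : lam * (n * γ / 2) = Real.log n / 2 := by simp only [lam]; field_simp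
  have hexpy : Real.exp (Real.log n / 2) = Real.sqrt n := by
    rw [Real.exp_half, Real.exp_log hn0]
  have hmgf : ∀ i, mgf (W i) P lam ≤ Real.exp (Real.log n / n + 16 / n) := by
    intro i
    have hb : ∀ ω, Real.exp (lam * W i ω) ≤
        1 + lam * |X i ω| + lam ^ 2 * Real.sqrt n * X i ω ^ 2 := by
      intro ω
      have h := exp_le_one_add_add_sq_mul (t := lam * W i ω) (B := Real.log n / 2)
        (mul_nonneg hlam (hW0 i ω)) (by rw [← hlamy]; gcongr; exact hWy i ω)
      rw [hexpy] at h
      refine h.trans ?_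
      have e1 : lam * W i ω ≤ lam * |X i ω| := by gcongr; exact hWX i ω
      have e2 : (lam * W i ω) ^ 2 * Real.sqrt n ≤ lam ^ 2 * Real.sqrt n * X i ω ^ 2 := by
        rw [mul_pow, ← sq_abs (X i ω)]
        have : W i ω ^ 2 ≤ |X i ω| ^ 2 := by gcongr; exacts [hW0 i ω, hWX i ω]
        calc _ = lam ^ 2 * Real.sqrt n * W i ω ^ 2 := by ring
          _ ≤ _ := by gcongr
      linarith
    have hI' : Integrable (fun ω => 1 + lam * |X i ω|) P :=
      (integrable_const _).add ((hI1 i).const_mul _)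
    have hI : Integrable (fun ω => 1 + lam * |X i ω| + lam ^ 2 * Real.sqrt n * X i ω ^ 2) P :=
      hI'.add ((hI2 i).const_mul _)
    have hIe : Integrable (fun ω => Real.exp (lam * W i ω)) P := by
      refine hI.mono' (by fun_prop) (ae_of_all _ fun ω => ?_)
      rw [Real.norm_of_nonneg (Real.exp_pos _).le]; exact hb ω
    have hlog : Real.log n ^ 2 ≤ 16 * Real.sqrt n := by
      have h := Real.log_le_rpow_div hn0.le (ε := 1 / 4) (by norm_num)
      have h4 : (n ^ (1 / 4 : ℝ)) ^ 2 = Real.sqrt n := by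
        rw [← Real.rpow_natCast, ← Real.rpow_mul hn0.le, Real.sqrt_eq_rpow]; norm_num
      have h5 := pow_le_pow_left₀ (Real.log_nonneg hn) h 2
      rw [div_pow, h4] at h5
      calc _ ≤ _ := h5
        _ = _ := by ring
    calc mgf (W i) P lam
        ≤ ∫ ω, (1 + lam * |X i ω| + lam ^ 2 * Real.sqrt n * X i ω ^ 2) ∂P :=
          integral_mono hIe hI hb
      _ = 1 + lam * ∫ ω, |X i ω| ∂P + lam ^ 2 * Real.sqrt n * ∫ ω, X i ω ^ 2 ∂P := by
          rw [integral_add hI' ((hI2 i).const_mul _),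
            integral_add (integrable_const _) ((hI1 i).const_mul _), integral_const_mul, integral_const_mul]
          simp
      _ ≤ 1 + lam * γ + lam ^ 2 * Real.sqrt n * γ ^ 2 := by
          gcongr
          exacts [h1 i, h2 i]
      _ = 1 + (Real.log n / n + Real.log n ^ 2 * Real.sqrt n / n ^ 2) := by
          rw [hlamγ]
          have : lam ^ 2 * Real.sqrt n * γ ^ 2 = (lam * γ) ^ 2 * Real.sqrt n := by ring
          rw [this, hlamγ]; ring
      _ ≤ 1 + (Real.log n / n + 16 / n) := by
          refine add_le_add le_rfl (add_le_add le_rfl ?_)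
          rw [div_le_div_iff₀ (by positivity) hn0]
          calc Real.log n ^ 2 * Real.sqrt n * n ≤ 16 * Real.sqrt n * Real.sqrt n * n := by gcongr
            _ = 16 * n ^ 2 := by rw [mul_assoc 16, Real.mul_self_sqrt hn0.le]; ring
      _ ≤ _ := by
          rw [add_comm 1]; exact Real.add_one_le_exp _
  have hexp_int : Integrable (fun ω => Real.exp (lam * (∑ i ∈ s, W i) ω)) P := by
    refine Integrable.of_bound (C := Real.exp (lam * ∑ _i ∈ s, n * γ / 2)) ?_
      (ae_of_all _ fun ω => ?_)
    · have : Measurable (∑ i ∈ s, W i) := by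
        have h := Finset.measurable_sum s fun i _ => hWm i
        convert! h using 1
        ext ω; simp
      fun_prop
    · rw [Real.norm_of_nonneg (Real.exp_pos _).le, Finset.sum_apply]
      gcongr with i
      exact hWy i ω
  have hch := measure_ge_le_exp_mul_mgf (X := ∑ i ∈ s, W i) (μ := P) (3 * n * γ) hlam hexp_int
  rw [hWind.mgf_sum hWm s] at hch
  have hset : {ω | 3 * n * γ ≤ ∑ i ∈ s, min |X i ω| (n * γ / 2)} =
      {ω | 3 * n * γ ≤ (∑ i ∈ s, W i) ω} := by
    ext ω; simp [W]
  rw [hset]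
  calc _ ≤ _ := hch
    _ ≤ Real.exp (-lam * (3 * n * γ)) * ∏ _i ∈ s, Real.exp (Real.log n / n + 16 / n) := by
        gcongr with i
        · intro i _; exact mgf_nonneg
        · exact hmgf i
    _ = Real.exp (-(3 * Real.log n) + n * (Real.log n / n + 16 / n)) := by
        rw [Finset.prod_const, ← Real.exp_nat_mul, ← Real.exp_add]
        congr 2
        have : lam * (3 * n * γ) = 3 * n * (lam * γ) := by ring
        rw [neg_mul, this, hlamγ]; field_simp
    _ = Real.exp 16 * n ^ (-2 : ℝ) := by
        rw [Real.rpow_def_of_pos hn0, ← Real.exp_add]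
        congr 1
        field_simp; ring

/-- A slice of `n` entries has absolute sum at most `3 n γ`, up to a polynomially small probability:
either one entry exceeds `n γ / 2`, or the sum of the truncated entries is large. -/
lemma measure_sum_abs_gt_le {ν : Measure ℝ} [IsProbabilityMeasure ν] {ε : ℝ} (hε : 0 < ε)
    (hmom : Integrable (fun x : ℝ => |x| ^ (2 + ε)) ν) (hγ : 0 < noiseScale ν ε)
    {X : ι → Ω → ℝ} (hX : ∀ i, Measurable (X i)) (hind : iIndepFun X P)
    (hν : ∀ i, P.map (X i) = ν) (s : Finset ι) (hs : 1 ≤ s.card) :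
    P {ω | 3 * s.card * noiseScale ν ε < ∑ i ∈ s, |X i ω|} ≤
      ENNReal.ofReal ((Real.exp 16 + 8) * (s.card : ℝ) ^ (-1 - min 1 ε)) := by
  set γ := noiseScale ν ε
  set n : ℝ := (s.card : ℝ) with hnn
  have hn : 1 ≤ n := by rw [hnn]; exact_mod_cast hs
  have hn0 : 0 < n := by linarith
  have hmin0 : 0 < min 1 ε := lt_min one_pos hε
  have hmin1 : min 1 ε ≤ 1 := min_le_left _ _
  set p := 2 + min 1 ε
  have hpε : p ≤ 2 + ε := by simp only [p]; gcongr; exact min_le_right _ _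
  have hpos : ∀ {q : ℝ}, 0 ≤ q → q ≤ 2 + ε → ∀ i, Integrable (fun ω => |X i ω| ^ q) P ∧
      ∫ ω, |X i ω| ^ q ∂P ≤ γ ^ q := by
    intro q hq hqε i
    obtain ⟨hI, hle⟩ := integrable_and_integral_rpow_le hε hmom hγ hq hqε
    have hm : AEStronglyMeasurable (fun x : ℝ => |x| ^ q) (P.map (X i)) :=
      (measurable_norm.pow_const q : Measurable fun x : ℝ => |x| ^ q).aestronglyMeasurable
    rw [← hν i] at hI hle
    rw [integral_map (hX i).aemeasurable hm] at hle
    exact ⟨hI.comp_measurable (hX i), by rw [hν i] at hle; exact hle⟩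
  have htrunc := measure_truncated_sum_ge_le hX hind hγ s hs
    (fun i => by simpa using (hpos zero_le_one (by linarith) i).1)
    (fun i => by simpa using (hpos zero_le_one (by linarith) i).2)
    (fun i => by simpa using (hpos zero_le_two (by linarith) i).1)
    (fun i => by simpa using (hpos zero_le_two (by linarith) i).2)
  have hbig : ∀ i, P {ω | n * γ / 2 < |X i ω|} ≤ ENNReal.ofReal (8 * n ^ (-p)) := by
    intro i
    obtain ⟨hI, hle⟩ := hpos (q := p) (by positivity) hpε i
    have hm := mul_meas_ge_le_integral_of_nonneg (μ := P) (ae_of_all _ fun ω => by positivity) hI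
      ((n * γ / 2) ^ p)
    have hsub : {ω | n * γ / 2 < |X i ω|} ⊆ {ω | (n * γ / 2) ^ p ≤ |X i ω| ^ p} := by
      intro ω hω
      exact Real.rpow_le_rpow (by positivity) (le_of_lt hω) (by positivity)
    refine (measure_mono hsub).trans ?_
    rw [← ofReal_measureReal]
    refine ENNReal.ofReal_le_ofReal ?_
    have h8 : (2 : ℝ) ^ p ≤ 8 := by
      calc (2 : ℝ) ^ p ≤ 2 ^ (3 : ℝ) :=
            Real.rpow_le_rpow_of_exponent_le one_le_two (by simp only [p]; linarith)
        _ = 8 := by norm_num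
    have hγp : 0 < γ ^ p := Real.rpow_pos_of_pos hγ _
    have hnp : 0 < n ^ p := Real.rpow_pos_of_pos hn0 _
    have h2p : (0 : ℝ) < 2 ^ p := Real.rpow_pos_of_pos two_pos _
    have e : (n * γ / 2) ^ p = n ^ p * γ ^ p / 2 ^ p := by
      rw [Real.div_rpow (by positivity) two_pos.le, Real.mul_rpow hn0.le hγ.le]
    rw [e] at hm ⊢
    have hle2 := hm.trans hle
    rw [Real.rpow_neg hn0.le, ← div_eq_mul_inv, le_div_iff₀ hnp]
    rw [div_mul_eq_mul_div, div_le_iff₀ h2p] at hle2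
    set M := P.real {ω | n ^ p * γ ^ p / 2 ^ p ≤ |X i ω| ^ p}
    have : M * n ^ p * γ ^ p ≤ 8 * γ ^ p := by nlinarith
    exact le_of_mul_le_mul_right this hγp
  have hcover : {ω | 3 * n * γ < ∑ i ∈ s, |X i ω|} ⊆
      {ω | 3 * n * γ ≤ ∑ i ∈ s, min |X i ω| (n * γ / 2)} ∪
        ⋃ i ∈ s, {ω | n * γ / 2 < |X i ω|} := by
    intro ω hω
    by_cases hc : ∃ i ∈ s, n * γ / 2 < |X i ω|
    · obtain ⟨i, hi, hlt⟩ := hc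
      exact Or.inr (Set.mem_biUnion hi hlt)
    · push Not at hc
      refine Or.inl ?_
      rw [Set.mem_ofPred_eq]
      rw [Finset.sum_congr rfl fun i hi => min_eq_left (hc i hi)]
      exact le_of_lt hω
  calc P {ω | 3 * n * γ < ∑ i ∈ s, |X i ω|}
      ≤ P {ω | 3 * n * γ ≤ ∑ i ∈ s, min |X i ω| (n * γ / 2)} +
          ∑ i ∈ s, P {ω | n * γ / 2 < |X i ω|} :=
        (measure_mono hcover).trans ((measure_union_le _ _).trans
          (by gcongr; exact measure_biUnion_finset_le _ _))
    _ ≤ ENNReal.ofReal (Real.exp 16 * n ^ (-2 : ℝ)) +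
          ∑ _i ∈ s, ENNReal.ofReal (8 * n ^ (-p)) := by
        refine add_le_add ?_ (Finset.sum_le_sum fun i _ => hbig i)
        rw [← ofReal_measureReal]
        exact ENNReal.ofReal_le_ofReal htrunc
    _ = ENNReal.ofReal (Real.exp 16 * n ^ (-2 : ℝ) + n * (8 * n ^ (-p))) := by
        rw [Finset.sum_const, nsmul_eq_mul, ENNReal.ofReal_add (by positivity) (by positivity),
          ENNReal.ofReal_mul hn0.le, hnn, ENNReal.ofReal_natCast]
    _ ≤ _ := by
        refine ENNReal.ofReal_le_ofReal ?_
        have e1 : n ^ (-2 : ℝ) ≤ n ^ (-1 - min 1 ε) :=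
          Real.rpow_le_rpow_of_exponent_le hn (by linarith)
        have e2 : n * (8 * n ^ (-p)) = 8 * n ^ (-1 - min 1 ε) := by
          have : n ^ (-1 - min 1 ε) = n * n ^ (-p) := by
            rw [← Real.rpow_one_add' hn0.le (by simp only [p]; linarith)]
            congr 1; simp only [p]; ring
          rw [this]; ring
        rw [e2, add_mul]
        gcongr

end Noise

/-! ### The expected loss -/

section ExpectedLoss

/-- Second differences of the pseudo-Huber function, integrated over an interval that is long
compared to `δ`, dominate a parabola. Translation reduces the integral to
`2 ∫₀ᵗ (g (R + s) - g (R - s)) ds`, and the integrand is at least `s`. -/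
lemma sq_le_integral_second_difference {δ R t : ℝ} (hδ : 0 < δ) (hR : δ ≤ R) (ht0 : 0 ≤ t)
    (htR : t ≤ R) :
    t ^ 2 ≤ ∫ x in (-R)..R, (Real.sqrt ((x + t) ^ 2 + δ ^ 2) + Real.sqrt ((x - t) ^ 2 + δ ^ 2) -
      2 * Real.sqrt (x ^ 2 + δ ^ 2)) := by
  set g : ℝ → ℝ := fun x => Real.sqrt (x ^ 2 + δ ^ 2)
  have hgc : Continuous g := by fun_prop
  have hgi : ∀ a b, IntervalIntegrable g volume a b := fun a b => hgc.intervalIntegrable a b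
  have heven : ∀ x, g (-x) = g x := fun x => by simp [g]
  have hI : ∫ x in (-R)..R, (g (x + t) + g (x - t) - 2 * g x) =
      2 * ∫ s in (0 : ℝ)..t, (g (R + s) - g (R - s)) := by
    have c1 : Continuous fun x => g (x + t) := by fun_prop
    have c2 : Continuous fun x => g (x - t) := by fun_prop
    have c12 : Continuous fun x => g (x + t) + g (x - t) := c1.add c2
    have c0 : Continuous fun x => 2 * g x := hgc.const_mul 2
    have c3 : Continuous fun s => g (R + s) := by fun_prop
    have c4 : Continuous fun s => g (R - s) := by fun_prop
    rw [intervalIntegral.integral_sub (c12.intervalIntegrable _ _)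
        (c0.intervalIntegrable _ _),
      intervalIntegral.integral_add (c1.intervalIntegrable _ _) (c2.intervalIntegrable _ _),
      intervalIntegral.integral_const_mul, intervalIntegral.integral_comp_add_right g t,
      intervalIntegral.integral_comp_sub_right g t,
      intervalIntegral.integral_sub (c3.intervalIntegrable _ _) (c4.intervalIntegrable _ _),
      intervalIntegral.integral_comp_add_left g R, intervalIntegral.integral_comp_sub_left g R]
    have r1 : ∫ x in (-R - t)..(-R), g x = ∫ x in R..(R + t), g x := by
      have := intervalIntegral.integral_comp_neg (a := R) (b := R + t) g
      simp only [heven] at this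
      rw [this]; congr 1; ring
    have r2 : ∫ x in (-R)..(-R + t), g x = ∫ x in (R - t)..R, g x := by
      have := intervalIntegral.integral_comp_neg (a := R - t) (b := R) g
      simp only [heven] at this
      rw [this]; congr 1; ring
    have s1 := intervalIntegral.integral_add_adjacent_intervals (hgi (-R) (-R + t))
      (hgi (-R + t) (R + t))
    have s2 := intervalIntegral.integral_add_adjacent_intervals (hgi (-R) R) (hgi R (R + t))
    have s3 := intervalIntegral.integral_add_adjacent_intervals (hgi (-R - t) (-R))
      (hgi (-R) (R - t))
    have s4 := intervalIntegral.integral_add_adjacent_intervals (hgi (-R) (R - t))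
      (hgi (R - t) R)
    rw [add_zero, sub_zero]
    linarith
  have hle : ∫ s in (0 : ℝ)..t, s ≤ ∫ s in (0 : ℝ)..t, (g (R + s) - g (R - s)) := by
    refine intervalIntegral.integral_mono_on ht0 (continuous_id.intervalIntegrable _ _)
      (Continuous.intervalIntegrable (by fun_prop) _ _) fun s hs => ?_
    obtain ⟨hs0, hst⟩ := hs
    have ha : 0 < g (R + s) := huber_pos hδ _
    have hb : 0 < g (R - s) := huber_pos hδ _
    have ha2 : g (R + s) ^ 2 = (R + s) ^ 2 + δ ^ 2 := Real.sq_sqrt (by positivity)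
    have hb2 : g (R - s) ^ 2 = (R - s) ^ 2 + δ ^ 2 := Real.sq_sqrt (by positivity)
    have ha3 : g (R + s) ≤ R + s + δ := by
      have := huber_le_abs_add hδ.le (R + s)
      rwa [abs_of_nonneg (by linarith)] at this
    have hb3 : g (R - s) ≤ R - s + δ := by
      have := huber_le_abs_add hδ.le (R - s)
      rwa [abs_of_nonneg (by linarith)] at this
    have hprod : (g (R + s) - g (R - s)) * (g (R + s) + g (R - s)) = 4 * R * s := by
      linear_combination ha2 - hb2
    have h4 : s * (g (R + s) + g (R - s)) ≤ 4 * R * s := by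
      have : s * (g (R + s) + g (R - s)) ≤ s * (4 * R) := by gcongr; linarith
      linarith
    rw [← hprod] at h4
    exact le_of_mul_le_mul_right h4 (add_pos ha hb)
  change t ^ 2 ≤ ∫ x in (-R)..R, (g (x + t) + g (x - t) - 2 * g x)
  rw [hI]
  rw [integral_id] at hle
  linarith

variable {ν : Measure ℝ} {ε δ b₀ K : ℝ}

lemma NoiseCondition.map_neg (h : NoiseCondition ν ε δ b₀ K) : ν.map Neg.neg = ν := by
  obtain ⟨f, hf, -, hν, hsymm, -⟩ := h.density
  ext s hs
  have hs' : MeasurableSet (Neg.neg ⁻¹' s : Set ℝ) := measurable_neg hs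
  rw [Measure.map_apply measurable_neg hs, hν, withDensity_apply _ hs', withDensity_apply _ hs]
  have := (Measure.measurePreserving_neg (volume : Measure ℝ)).setLIntegral_comp_preimage hs
    hf.ennreal_ofReal
  rw [← this]
  exact lintegral_congr fun x => by rw [← hsymm x]

/-- The law of the noise dominates a multiple of Lebesgue measure near the origin. -/
lemma NoiseCondition.restrict_le (h : NoiseCondition ν ε δ b₀ K) :
    ENNReal.ofReal b₀⁻¹ • volume.restrict
      (Set.Icc (-(K * (6 * noiseScale ν ε + δ))) (K * (6 * noiseScale ν ε + δ))) ≤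
    ν.restrict (Set.Icc (-(K * (6 * noiseScale ν ε + δ))) (K * (6 * noiseScale ν ε + δ))) := by
  obtain ⟨f, hf, -, hν, -, hlow⟩ := h.density
  set R := K * (6 * noiseScale ν ε + δ)
  rw [hν, restrict_withDensity measurableSet_Icc, ← withDensity_const]
  refine withDensity_mono ?_
  filter_upwards [ae_restrict_mem measurableSet_Icc] with x hx
  exact ENNReal.ofReal_le_ofReal (hlow x (abs_le.2 hx))

lemma NoiseCondition.two_mul_le [IsProbabilityMeasure ν] (h : NoiseCondition ν ε δ b₀ K) :
    2 * (K * (6 * noiseScale ν ε + δ)) ≤ b₀ := by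
  have h1 := h.restrict_le Set.univ
  set R := K * (6 * noiseScale ν ε + δ)
  rw [Measure.smul_apply, Measure.restrict_apply_univ, Measure.restrict_apply_univ,
    Real.volume_Icc, smul_eq_mul, ← ENNReal.ofReal_mul (inv_nonneg.2 h.b₀_pos.le)] at h1
  have h2 := h1.trans prob_le_one
  rw [ENNReal.ofReal_le_one, inv_mul_le_iff₀ h.b₀_pos] at h2
  linarith

lemma NoiseCondition.noiseScale_pos [IsProbabilityMeasure ν] (h : NoiseCondition ν ε δ b₀ K) :
    0 < noiseScale ν ε := by
  have hε := h.eps_pos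
  have h0 : 0 ≤ ∫ x, |x| ^ (2 + ε) ∂ν := integral_nonneg fun x => by positivity
  refine Real.rpow_pos_of_pos (h0.lt_of_ne' fun hz => ?_) _
  rw [integral_eq_zero_iff_of_nonneg (fun x => by positivity) h.moment] at hz
  obtain ⟨f, -, -, hν, -⟩ := h.density
  have hac : ν ≪ volume := hν ▸ withDensity_absolutelyContinuous _ _
  have h1 : ν {0} = 0 := hac (by simp)
  have h2 : ν {0}ᶜ = 0 := by
    refine measure_mono_null (fun x hx => ?_) hz
    simp only [Set.mem_compl_iff, Set.mem_singleton_iff] at hx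
    exact (Real.rpow_pos_of_pos (abs_pos.2 hx) _).ne'
  have h3 : ν Set.univ ≤ ν {0} + ν {0}ᶜ := by
    rw [← Set.union_compl_self ({0} : Set ℝ)]; exact measure_union_le _ _
  rw [h1, h2, measure_univ] at h3
  simp at h3

lemma NoiseCondition.integral_comp_neg (h : NoiseCondition ν ε δ b₀ K) (f : ℝ → ℝ) :
    ∫ x, f (-x) ∂ν = ∫ x, f x ∂ν := by
  conv_rhs => rw [← h.map_neg]
  exact (integral_map_equiv (MeasurableEquiv.neg ℝ) f).symm

/-- The increments of the pseudo-Huber loss under a shift of the data, as a family of functions of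
the noise. -/
lemma isContractionFamily_huber (hδ : 0 < δ) :
    IsContractionFamily fun t x => Real.sqrt ((t - x) ^ 2 + δ ^ 2) - Real.sqrt (x ^ 2 + δ ^ 2) where
  measurable t := by fun_prop
  zero x := by simp
  abs_sub_le s t x := by
    have := abs_huber_sub_le hδ (s - x) (t - x)
    simpa using this

lemma isContractionFamily_huberDeriv (hδ : 0 < δ) :
    IsContractionFamily fun t x => t * huberDeriv δ (-x) where
  measurable t := ((continuous_huberDeriv hδ).measurable.comp measurable_neg).const_mul t
  zero x := by simp
  abs_sub_le s t x := by
    rw [← sub_mul, abs_mul]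
    exact mul_le_of_le_one_right (abs_nonneg _) (abs_huberDeriv_le_one hδ _)

/-- By symmetry the expected increment is half the expectation of a second difference, which is
nonnegative by convexity; on the interval where the density is at least `1 / b₀`, it integrates to
at least `t² / b₀`. -/
lemma NoiseCondition.sq_div_le_expected_increment [IsProbabilityMeasure ν]
    (h : NoiseCondition ν ε δ b₀ K) (hδ : 0 < δ) (hR : δ ≤ K * (6 * noiseScale ν ε + δ)) {t : ℝ}
    (ht : |t| ≤ K * (6 * noiseScale ν ε + δ)) :
    t ^ 2 / (2 * b₀) ≤
      ∫ x, (Real.sqrt ((t - x) ^ 2 + δ ^ 2) - Real.sqrt (x ^ 2 + δ ^ 2)) ∂ν := by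
  have hb := h.b₀_pos
  have hdom := h.restrict_le
  set R := K * (6 * noiseScale ν ε + δ)
  set ψ : ℝ → ℝ := fun x => Real.sqrt ((t - x) ^ 2 + δ ^ 2) - Real.sqrt (x ^ 2 + δ ^ 2)
  let D : ℝ → ℝ := fun x => Real.sqrt ((x + |t|) ^ 2 + δ ^ 2) +
    Real.sqrt ((x - |t|) ^ 2 + δ ^ 2) - 2 * Real.sqrt (x ^ 2 + δ ^ 2)
  have hψi : Integrable ψ ν := (isContractionFamily_huber hδ).integrable measurable_id t
  have hψni : Integrable (fun x => ψ (-x)) ν :=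
    (isContractionFamily_huber hδ).integrable measurable_neg t
  have hD : ∀ x, ψ x + ψ (-x) = D x := by
    intro x
    simp only [ψ, D]
    rcases abs_choice t with h | h
    · rw [h, ← neg_sq (t - x)]; ring_nf
    · rw [h, ← neg_sq (t - x)]; ring_nf
  have hDi : Integrable D ν := by
    have := hψi.add hψni
    exact this.congr (ae_of_all _ fun x => hD x)
  have hDint : ∫ x, D x ∂ν = 2 * ∫ x, ψ x ∂ν := by
    rw [← integral_congr_ae (ae_of_all _ hD), integral_add hψi hψni, h.integral_comp_neg]
    ring
  have hD0 : ∀ x, 0 ≤ D x := by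
    intro x
    set a := |t|
    have h1 := huber_pos hδ (x + a)
    have h2 := huber_pos hδ (x - a)
    have h3 := huber_pos hδ x
    simp only [D]
    -- the triangle inequality in the plane for `(x + a, δ)` and `(x - a, δ)`
    have h4 : 4 * Real.sqrt (x ^ 2 + δ ^ 2) ^ 2 ≤
        (Real.sqrt ((x + a) ^ 2 + δ ^ 2) + Real.sqrt ((x - a) ^ 2 + δ ^ 2)) ^ 2 := by
      have h5 : (x + a) * (x - a) + δ ^ 2 ≤
          Real.sqrt ((x + a) ^ 2 + δ ^ 2) * Real.sqrt ((x - a) ^ 2 + δ ^ 2) := by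
        rw [← Real.sqrt_mul (by positivity)]
        refine Real.le_sqrt_of_sq_le ?_
        nlinarith [sq_nonneg (δ * ((x + a) - (x - a)))]
      rw [add_sq, Real.sq_sqrt (by positivity), Real.sq_sqrt (by positivity),
        Real.sq_sqrt (by positivity)]
      nlinarith
    nlinarith
  have hDset : ENNReal.toReal (ENNReal.ofReal b₀⁻¹) * ∫ x in Set.Icc (-R) R, D x ≤ ∫ x, D x ∂ν := by
    calc _ = ∫ x, D x ∂(ENNReal.ofReal b₀⁻¹ • volume.restrict (Set.Icc (-R) R)) := by
          rw [integral_smul_measure, smul_eq_mul]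
      _ ≤ ∫ x in Set.Icc (-R) R, D x ∂ν :=
          integral_mono_measure hdom (ae_of_all _ hD0) hDi.integrableOn
      _ ≤ ∫ x, D x ∂ν := setIntegral_le_integral hDi (ae_of_all _ hD0)
  have hmain := sq_le_integral_second_difference hδ hR (abs_nonneg t) ht
  rw [sq_abs, intervalIntegral.integral_of_le (by linarith),
    ← integral_Icc_eq_integral_Ioc] at hmain
  rw [ENNReal.toReal_ofReal (inv_nonneg.2 hb.le), hDint] at hDset
  have h6 : b₀⁻¹ * t ^ 2 ≤ 2 * ∫ x, ψ x ∂ν :=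
    (mul_le_mul_of_nonneg_left hmain (inv_nonneg.2 hb.le)).trans hDset
  have h7 : t ^ 2 / (2 * b₀) = b₀⁻¹ * t ^ 2 / 2 := by field_simp
  rw [h7]
  linarith

end ExpectedLoss

/-! ### Regularity of the loss -/

section Regularity

variable {m : ℕ} {d r : Fin m → ℕ} {Ω : Type*}

lemma sub_observed_apply (Tstar T : Tensor d) (Ξ : MultiIndex d → Ω → ℝ) (ω : Ω)
    (i : MultiIndex d) : (T - observed Tstar Ξ ω) i = (T - Tstar) i - Ξ i ω := by
  simp [observed]; ring

lemma self_sub_observed_apply (Tstar : Tensor d) (Ξ : MultiIndex d → Ω → ℝ) (ω : Ω)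
    (i : MultiIndex d) : (Tstar - observed Tstar Ξ ω) i = -Ξ i ω := by
  rw [sub_observed_apply, sub_self]; simp

lemma huberObj_sub_ge {Tstar : Tensor d} {Ξ : MultiIndex d → Ω → ℝ} {ω : Ω} {δ γ : ℝ}
    (hδ : 0 < δ) (hΞ : ∑ i, |Ξ i ω| ≤ 3 * dStar d * γ) (T : Tensor d) :
    (maxNorm fun i => (T - Tstar) i)⁻¹ * ‖T - Tstar‖ ^ 2 - 6 * dStar d * γ - dStar d * δ ≤
      huberObj δ (observed Tstar Ξ ω) T - huberObj δ (observed Tstar Ξ ω) Tstar := by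
  have h := pseudoHuber_sub_ge hδ.le (fun i => (T - Tstar) i) (fun i => Ξ i ω)
  rw [card_multiIndex] at h
  simp only [huberObj, sub_observed_apply Tstar T, self_sub_observed_apply]
  rw [EuclideanSpace.real_norm_sq_eq]
  linarith

lemma huberSlice_sub_ge {Tstar : Tensor d} {Ξ : MultiIndex d → Ω → ℝ} {ω : Ω} {δ γ : ℝ}
    (hδ : 0 < δ) (k : Fin m) (j : Fin (d k))
    (hΞ : ∑ I, |Ξ ((Equiv.piSplitAt k fun j => Fin (d j)).symm (j, I)) ω| ≤ 3 * dMinus d k * γ)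
    (T : Tensor d) :
    (maxNorm (matricize k (T - Tstar) j))⁻¹ * l2Norm (matricize k (T - Tstar) j) ^ 2
        - 6 * dMinus d k * γ - dMinus d k * δ ≤
      huberSlice δ (observed Tstar Ξ ω) k j T - huberSlice δ (observed Tstar Ξ ω) k j Tstar := by
  have h := pseudoHuber_sub_ge hδ.le (matricize k (T - Tstar) j)
    (fun I => Ξ ((Equiv.piSplitAt k fun j => Fin (d j)).symm (j, I)) ω)
  rw [card_otherIndex] at h
  have e1 : matricize k (T - observed Tstar Ξ ω) j = fun I => matricize k (T - Tstar) j I -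
      Ξ ((Equiv.piSplitAt k fun j => Fin (d j)).symm (j, I)) ω :=
    funext fun I => sub_observed_apply Tstar T Ξ ω _
  have e2 : matricize k (Tstar - observed Tstar Ξ ω) j = fun I =>
      -Ξ ((Equiv.piSplitAt k fun j => Fin (d j)).symm (j, I)) ω :=
    funext fun I => self_sub_observed_apply Tstar Ξ ω _
  rw [huberSlice, huberSlice, e1, e2, l2Norm_sq]
  linarith

/-- All slices of the noise are simultaneously small in `ℓ₁`. -/
lemma measure_exists_slice_gt_le [MeasurableSpace Ω] {P : Measure Ω} [IsProbabilityMeasure P]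
    {ν : Measure ℝ} [IsProbabilityMeasure ν] {ε : ℝ} (hε : 0 < ε)
    (hmom : Integrable (fun x : ℝ => |x| ^ (2 + ε)) ν) (hγ : 0 < noiseScale ν ε)
    {Ξ : MultiIndex d → Ω → ℝ} (hΞ : ∀ i, Measurable (Ξ i)) (hind : iIndepFun Ξ P)
    (hν : ∀ i, P.map (Ξ i) = ν) (hd : ∀ k, 1 ≤ dMinus d k) :
    P {ω | ∃ (k : Fin m) (j : Fin (d k)), 3 * dMinus d k * noiseScale ν ε <
        ∑ I, |Ξ ((Equiv.piSplitAt k fun j => Fin (d j)).symm (j, I)) ω|} ≤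
      ENNReal.ofReal ((Real.exp 16 + 8) *
        ∑ k, (d k : ℝ) * (dMinus d k : ℝ) ^ (-1 - min 1 ε)) := by
  have hone : ∀ (k : Fin m) (j : Fin (d k)),
      P {ω | 3 * dMinus d k * noiseScale ν ε <
        ∑ I, |Ξ ((Equiv.piSplitAt k fun j => Fin (d j)).symm (j, I)) ω|} ≤
      ENNReal.ofReal ((Real.exp 16 + 8) * (dMinus d k : ℝ) ^ (-1 - min 1 ε)) := by
    intro k j
    have hinj : Function.Injective
        fun I => (Equiv.piSplitAt k fun j => Fin (d j)).symm (j, I) := fun I J h => by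
      simpa using h
    have h := measure_sum_abs_gt_le hε hmom hγ (P := P)
      (X := fun I => Ξ ((Equiv.piSplitAt k fun j => Fin (d j)).symm (j, I)))
      (fun I => hΞ _) (hind.precomp hinj) (fun I => hν _) Finset.univ
      (by rw [Finset.card_univ, card_otherIndex]; exact hd k)
    rwa [Finset.card_univ, card_otherIndex] at h
  have hset : {ω | ∃ (k : Fin m) (j : Fin (d k)), 3 * dMinus d k * noiseScale ν ε <
        ∑ I, |Ξ ((Equiv.piSplitAt k fun j => Fin (d j)).symm (j, I)) ω|} =
      ⋃ k, ⋃ j, {ω | 3 * dMinus d k * noiseScale ν ε <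
        ∑ I, |Ξ ((Equiv.piSplitAt k fun j => Fin (d j)).symm (j, I)) ω|} := by
    ext ω; simp
  rw [hset]
  calc _ ≤ ∑ k, ∑ j : Fin (d k), P {ω | 3 * dMinus d k * noiseScale ν ε <
        ∑ I, |Ξ ((Equiv.piSplitAt k fun j => Fin (d j)).symm (j, I)) ω|} :=
        (measure_iUnion_fintype_le _ _).trans
          (Finset.sum_le_sum fun k _ => measure_iUnion_fintype_le _ _)
    _ ≤ ∑ k, ∑ _j : Fin (d k),
          ENNReal.ofReal ((Real.exp 16 + 8) * (dMinus d k : ℝ) ^ (-1 - min 1 ε)) :=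
        Finset.sum_le_sum fun k _ => Finset.sum_le_sum fun j _ => hone k j
    _ = _ := by
        rw [Finset.mul_sum, ENNReal.ofReal_sum_of_nonneg (fun k _ => by positivity)]
        refine Finset.sum_congr rfl fun k _ => ?_
        rw [Finset.sum_const, Finset.card_univ, Fintype.card_fin, nsmul_eq_mul,
          mul_left_comm (Real.exp 16 + 8), ENNReal.ofReal_mul (by positivity : (0 : ℝ) ≤ d k),
          ENNReal.ofReal_natCast]

/-- The increments of the loss are the fluctuation of a centred sum plus its expectation. -/
lemma huberObj_sub_ge_of_centeredSum [MeasurableSpace Ω] {P : Measure Ω} {ν : Measure ℝ}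
    [IsProbabilityMeasure ν] {ε δ b₀ K : ℝ}
    (h : NoiseCondition ν ε δ b₀ K) (hδ : 0 < δ) (hR : δ ≤ K * (6 * noiseScale ν ε + δ))
    {Ξ : MultiIndex d → Ω → ℝ} (hΞ : ∀ i, Measurable (Ξ i)) (hν : ∀ i, P.map (Ξ i) = ν)
    (Tstar T : Tensor d)
    (hT : (maxNorm fun i => (T - Tstar) i) ≤ K * (6 * noiseScale ν ε + δ)) (ω : Ω) :
    ‖T - Tstar‖ ^ 2 / (2 * b₀) + centeredSum P
        (fun t x => Real.sqrt ((t - x) ^ 2 + δ ^ 2) - Real.sqrt (x ^ 2 + δ ^ 2)) Ξ (T - Tstar) ω ≤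
      huberObj δ (observed Tstar Ξ ω) T - huberObj δ (observed Tstar Ξ ω) Tstar := by
  have hE : ∀ i, (T - Tstar) i ^ 2 / (2 * b₀) ≤
      ∫ ω', (Real.sqrt (((T - Tstar) i - Ξ i ω') ^ 2 + δ ^ 2) -
        Real.sqrt (Ξ i ω' ^ 2 + δ ^ 2)) ∂P := by
    intro i
    have hi : |(T - Tstar) i| ≤ K * (6 * noiseScale ν ε + δ) :=
      (le_ciSup (f := fun i => |(T - Tstar) i|) (Set.finite_range _).bddAbove i).trans hT
    refine (h.sq_div_le_expected_increment hδ hR hi).trans (le_of_eq ?_)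
    rw [← hν i, integral_map (hΞ i).aemeasurable]
    exact ((isContractionFamily_huber hδ).measurable _).aestronglyMeasurable
  simp only [huberObj, pseudoHuber, sub_observed_apply Tstar T, self_sub_observed_apply, neg_sq]
  rw [centeredSum, EuclideanSpace.real_norm_sq_eq, Finset.sum_div, ← Finset.sum_sub_distrib,
    ← Finset.sum_add_distrib]
  refine Finset.sum_le_sum fun i _ => ?_
  have := hE i
  linarith

/-- The pairing with the gradient at the true tensor is a centred sum, because the noise is
symmetric. -/
lemma centeredSum_huberDeriv [MeasurableSpace Ω] {P : Measure Ω} {ν : Measure ℝ} {ε δ b₀ K : ℝ}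
    (h : NoiseCondition ν ε δ b₀ K)
    (hδ : 0 < δ) {Ξ : MultiIndex d → Ω → ℝ} (hΞ : ∀ i, Measurable (Ξ i))
    (hν : ∀ i, P.map (Ξ i) = ν) (H : Tensor d) (ω : Ω) :
    centeredSum P (fun t x => t * huberDeriv δ (-x)) Ξ H ω =
      inner ℝ (WithLp.toLp 2 fun i => huberDeriv δ (-Ξ i ω) : Tensor d) H := by
  have h0 : ∫ x, huberDeriv δ (-x) ∂ν = 0 := by
    have h1 := h.integral_comp_neg (huberDeriv δ)
    have h2 : ∫ x, huberDeriv δ (-x) ∂ν = -∫ x, huberDeriv δ x ∂ν := by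
      rw [← integral_neg]; exact integral_congr_ae (ae_of_all _ fun x => huberDeriv_neg δ x)
    linarith
  have hm : Measurable fun x => huberDeriv δ (-x) :=
    (continuous_huberDeriv hδ).measurable.comp measurable_neg
  have hE : ∀ i, ∫ ω', H i * huberDeriv δ (-Ξ i ω') ∂P = 0 := by
    intro i
    rw [integral_const_mul]
    have : ∫ ω', huberDeriv δ (-Ξ i ω') ∂P = ∫ x, huberDeriv δ (-x) ∂ν := by
      rw [← hν i, integral_map (hΞ i).aemeasurable hm.aestronglyMeasurable]
    rw [this, h0, mul_zero]
  simp only [centeredSum, hE, sub_zero, PiLp.inner_apply, RCLike.inner_apply, conj_trivial]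

/-- The gradient of the loss is `δ⁻¹`-Lipschitz, and its fluctuation at the true tensor is
controlled on low-rank directions. -/
lemma norm_starProjection_gradient_le {Tstar T G : Tensor d} {Ξ : MultiIndex d → Ω → ℝ} {ω : Ω}
    {δ a : ℝ} (hδ : 0 < δ) (ha : 0 ≤ a)
    (hG : IsSubgradient (huberObj δ (observed Tstar Ξ ω)) T G)
    (hΞ : ∀ H ∈ tuckerRankLE d r,
      |inner ℝ (WithLp.toLp 2 fun i => huberDeriv δ (-Ξ i ω) : Tensor d) H| ≤ a * ‖H‖)
    {𝕋 : Submodule ℝ (Tensor d)} (h𝕋 : IsTangentSpace r T 𝕋) :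
    ‖𝕋.starProjection G‖ ≤ δ⁻¹ * ‖T - Tstar‖ + (2 * m + 1) * a := by
  set G₀ : Tensor d := WithLp.toLp 2 fun i => huberDeriv δ (-Ξ i ω)
  have h1 : ‖G - G₀‖ ≤ δ⁻¹ * ‖T - Tstar‖ := by
    refine le_of_sq_le_sq ?_ (by positivity)
    rw [mul_pow, EuclideanSpace.real_norm_sq_eq, EuclideanSpace.real_norm_sq_eq, Finset.mul_sum]
    refine Finset.sum_le_sum fun i _ => ?_
    have e : (G - G₀) i = huberDeriv δ ((T - Tstar) i - Ξ i ω) - huberDeriv δ (-Ξ i ω) := by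
      rw [PiLp.sub_apply, hG.apply_eq hδ i, ← PiLp.sub_apply, sub_observed_apply]
    have h := abs_huberDeriv_sub_le hδ ((T - Tstar) i - Ξ i ω) (-Ξ i ω)
    rw [← e, sub_neg_eq_add, sub_add_cancel] at h
    calc (G - G₀) i ^ 2 = |(G - G₀) i| ^ 2 := (sq_abs _).symm
      _ ≤ (δ⁻¹ * |(T - Tstar) i|) ^ 2 := by gcongr
      _ = _ := by rw [mul_pow, sq_abs]
  have h2 : 𝕋.starProjection G = 𝕋.starProjection (G - G₀) + 𝕋.starProjection G₀ := by
    rw [← map_add, sub_add_cancel]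
  rw [h2]
  exact (norm_add_le _ _).trans (add_le_add
    ((Submodule.norm_starProjection_apply_le _ _).trans h1)
    (norm_starProjection_tangent_le h𝕋 ha hΞ))

lemma one_le_radiusConst {μ : ℝ} (hμ : 1 ≤ μ) (hr : ∀ k, 1 ≤ r k) : 1 ≤ radiusConst μ r := by
  have h1 : (1 : ℝ) ≤ ((∏ k, r k : ℕ) : ℝ) := by
    exact_mod_cast Finset.one_le_prod' fun k _ => hr k
  have h2 : (1 : ℝ) ≤ 3 ^ m := one_le_pow₀ (by norm_num)
  have h3 : (1 : ℝ) ≤ μ ^ m := one_le_pow₀ hμ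
  have h4 : (1 : ℝ) ≤ (5 * m + 1) ^ 2 := one_le_pow₀ (by linarith [Nat.cast_nonneg (α := ℝ) m])
  have h5 : (1 : ℝ) ≤ 72 := by norm_num
  unfold radiusConst
  exact one_le_mul_of_one_le_of_one_le (one_le_mul_of_one_le_of_one_le
    (one_le_mul_of_one_le_of_one_le (one_le_mul_of_one_le_of_one_le h5 h4) h2) h3) h1

lemma sqrt_DoF_two_mul_le (hm : 1 ≤ m) (d r : Fin m → ℕ) :
    Real.sqrt (DoF d fun k => 2 * r k) ≤ 2 ^ m * Real.sqrt (DoF d r) := by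
  have h1 : (1 : ℝ) ≤ 2 ^ m := one_le_pow₀ one_le_two
  refine Real.sqrt_le_iff.2 ⟨by positivity, ?_⟩
  rw [mul_pow, Real.sq_sqrt (by positivity)]
  calc ((DoF d fun k => 2 * r k : ℕ) : ℝ) ≤ 2 ^ m * DoF d r := by
        exact_mod_cast DoF_two_mul_le hm d r
    _ ≤ _ := by gcongr; nlinarith

end Regularity

theorem mainTheorem6 :
    ∃ c : ℝ, 0 < c ∧ ∃ c₂ : ℝ, 0 < c₂ ∧ ∀ m : ℕ, 1 ≤ m → ∃ c₁ : ℝ, 0 < c₁ ∧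
    ∀ (d r : Fin m → ℕ), (∀ k, 1 ≤ r k) →
    ∀ (Tstar : Tensor d) (μstar : ℝ), IsIncoherent r μstar Tstar →
    ∀ (ν : Measure ℝ) (ε δ b₀ : ℝ), 0 < δ →
      NoiseCondition ν ε δ b₀ (radiusConst μstar r) →
    ∀ (Ω : Type*) [MeasurableSpace Ω] (P : Measure Ω) [IsProbabilityMeasure P]
      (Ξ : MultiIndex d → Ω → ℝ),
      (∀ i, Measurable (Ξ i)) → iIndepFun Ξ P → (∀ i, P.map (Ξ i) = ν) →
    ∃ E : Set Ω, MeasurableSet E ∧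
      1 - c * ∑ k, (d k : ℝ) * (dMinus d k : ℝ) ^ (-1 - min 1 ε)
          - Real.exp (-(DoF d r : ℝ) / 2) < P.real E ∧
      ∀ ω ∈ E,
        -- Phase one
        (∀ T : Tensor d,
          (∀ G : Tensor d, IsSubgradient (huberObj δ (observed Tstar Ξ ω)) T G →
            ∀ (ρ : Fin m → ℕ) (𝕋 : Submodule ℝ (Tensor d)), IsTangentSpace ρ T 𝕋 →
              ‖𝕋.starProjection G‖ ≤ Real.sqrt (dStar d)) ∧
          huberObj δ (observed Tstar Ξ ω) T - huberObj δ (observed Tstar Ξ ω) Tstar ≥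
            (maxNorm fun i => (T - Tstar) i)⁻¹ * ‖T - Tstar‖ ^ 2
              - 6 * dStar d * noiseScale ν ε - dStar d * δ ∧
          ∀ (ρ : Fin m → ℕ) (μ : ℝ), IsIncoherent ρ μ T → ∀ k : Fin m,
            (∀ G : Tensor d, IsSubgradient (huberObj δ (observed Tstar Ξ ω)) T G →
              ∀ 𝕋 : Submodule ℝ (Tensor d), IsTangentSpace ρ T 𝕋 →
                twoInfNorm (matricize k (𝕋.starProjection G)) ≤
                  Real.sqrt (3 * μ * ρ k * dMinus d k)) ∧
            ∀ j : Fin (d k),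
              huberSlice δ (observed Tstar Ξ ω) k j T
                  - huberSlice δ (observed Tstar Ξ ω) k j Tstar ≥
                (maxNorm (matricize k (T - Tstar) j))⁻¹ * l2Norm (matricize k (T - Tstar) j) ^ 2
                  - 6 * dMinus d k * noiseScale ν ε - dMinus d k * δ) ∧
        -- Phase two
        (∀ T ∈ tuckerRankLE d r,
          (maxNorm fun i => (T - Tstar) i) ≤
            radiusConst μstar r * (6 * noiseScale ν ε + δ) →
          c₁ * b₀ * Real.sqrt (DoF d r) ≤ ‖T - Tstar‖ →
          (∀ G : Tensor d, IsSubgradient (huberObj δ (observed Tstar Ξ ω)) T G →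
            ∀ 𝕋 : Submodule ℝ (Tensor d), IsTangentSpace r T 𝕋 →
              ‖𝕋.starProjection G‖ ≤ c₂ * δ⁻¹ * Real.sqrt ((m : ℝ) + 1) * ‖T - Tstar‖) ∧
          huberObj δ (observed Tstar Ξ ω) T - huberObj δ (observed Tstar Ξ ω) Tstar ≥
            (4 * b₀)⁻¹ * ‖T - Tstar‖ ^ 2) := by
  -- the final estimates need `c₁` to dominate both `4 * 128 (m + 1) 2 ^ m`, so that the fluctuation
  -- beyond the radius is at most half of the expected growth, and `(2 m + 1) * 128 (m + 1) 2 ^ m`,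
  -- so that the gradient at the true tensor is absorbed by the distance
  refine ⟨Real.exp 16 + 9, by positivity, 2, two_pos, fun m hm =>
    ⟨4 * (2 * m + 1) * (128 * (m + 1) * 2 ^ m), by positivity, ?_⟩⟩
  intro d r hr Tstar μstar hinc ν ε δ b₀ hδ hnoise Ω _ P _ Ξ hΞ hind hν
  set c₁ : ℝ := 4 * (2 * m + 1) * (128 * (m + 1) * 2 ^ m) with hc₁
  have hb := hnoise.b₀_pos
  have hε := hnoise.eps_pos
  obtain ⟨C₀, U₀, hU₀, -⟩ := hinc.2
  have hd : ∀ k, 1 ≤ d k := fun k => (hr k).trans (hU₀.rank_le_dim k)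
  have hdM : ∀ k, 1 ≤ dMinus d k := fun k => Finset.one_le_prod' fun j _ => hd j
  have hprob : IsProbabilityMeasure ν := by
    rw [← hν fun k => ⟨0, hd k⟩]
    exact Measure.isProbabilityMeasure_map (hΞ _).aemeasurable
  have hγ := hnoise.noiseScale_pos
  have hK : 1 ≤ radiusConst μstar r :=
    one_le_radiusConst (hinc.one_le ⟨0, hm⟩ (hr _)) hr
  have hR : δ ≤ radiusConst μstar r * (6 * noiseScale ν ε + δ) := by nlinarith
  have hbδ : δ ≤ b₀ := by
    have := hnoise.two_mul_le
    linarith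
  have hDoF : 1 ≤ DoF d r :=
    (Finset.one_le_prod' fun k _ => hr k : 1 ≤ ∏ k, r k).trans (Nat.le_add_right _ _)
  have hDoF' : (1 : ℝ) ≤ DoF d r := by exact_mod_cast hDoF
  have hDoF2 : 2 * DoF d r ≤ DoF d fun k => 2 * r k := two_mul_DoF_le hm d r
  have hDoF2' : 2 * (DoF d r : ℝ) ≤ DoF d fun k => 2 * r k := by exact_mod_cast hDoF2
  set ρ₀ := c₁ * b₀ * Real.sqrt (DoF d r)
  have hρ₀ : 0 < ρ₀ := by positivity
  -- The three exceptional events: `B₁` for the absolute sums of the noise over slices, `B₂` for the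
  -- gradient at the true tensor, `B₃` for the fluctuation of the loss. In the last two the ranks are
  -- doubled: this is the rank of a difference, and it makes up for the constants in `exp (-DoF / 2)`.
  set ψ : ℝ → ℝ → ℝ := fun t x => Real.sqrt ((t - x) ^ 2 + δ ^ 2) - Real.sqrt (x ^ 2 + δ ^ 2)
  set χ : ℝ → ℝ → ℝ := fun t x => t * huberDeriv δ (-x) with hχdef
  have hψ : IsContractionFamily ψ := isContractionFamily_huber hδ
  have hχ : IsContractionFamily χ := isContractionFamily_huberDeriv hδ
  set B₁ : Set Ω := {ω | ∃ (k : Fin m) (j : Fin (d k)), 3 * dMinus d k * noiseScale ν ε <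
    ∑ I, |Ξ ((Equiv.piSplitAt k fun j => Fin (d j)).symm (j, I)) ω|}
  set B₂ : Set Ω := {ω | ∃ H ∈ tuckerRankLE d fun k => 2 * r k, ‖H‖ ≤ 1 ∧
    64 * (1 * (m + 1)) * Real.sqrt (DoF d fun k => 2 * r k) * 1 <
      |centeredSum P χ Ξ H ω - centeredSum P χ Ξ 0 ω|}
  set B₃ : Set Ω := {ω | ∃ H ∈ tuckerRankLE d fun k => 2 * r k, ρ₀ ≤ ‖H‖ ∧
    128 * (m + 1) * Real.sqrt (DoF d fun k => 2 * r k) * ‖H‖ ^ 2 / ρ₀ <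
      |centeredSum P ψ Ξ H ω - centeredSum P ψ Ξ 0 ω|}
  have hPB₁ : P B₁ ≤ _ := measure_exists_slice_gt_le hε hnoise.moment hγ hΞ hind hν hdM
  have hPB₂ : P B₂ ≤ _ := measure_lowRank_sup_le P (centeredSum P χ Ξ)
    (continuous_centeredSum hχ hΞ) (subGaussianIncrements_centeredSum hχ hΞ hind) (by omega)
    one_pos le_rfl
  have hPB₃ : P B₃ ≤ _ := measure_lowRank_peeling_le P (centeredSum P ψ Ξ)
    (continuous_centeredSum hψ hΞ) (subGaussianIncrements_centeredSum hψ hΞ hind) (by omega) hρ₀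
  set S : ℝ := ∑ k, (d k : ℝ) * (dMinus d k : ℝ) ^ (-1 - min 1 ε)
  have hSpos : 0 < S := by
    refine Finset.sum_pos (fun k _ => ?_) ⟨⟨0, hm⟩, Finset.mem_univ _⟩
    have h1 : (0 : ℝ) < d k := by exact_mod_cast hd k
    have h2 : (0 : ℝ) < dMinus d k := by exact_mod_cast hdM k
    positivity
  have hPB : P (B₁ ∪ B₂ ∪ B₃) ≤
      ENNReal.ofReal ((Real.exp 16 + 8) * S + Real.exp (-(DoF d r : ℝ) / 2)) := by
    calc P (B₁ ∪ B₂ ∪ B₃) ≤ P B₁ + P B₂ + P B₃ :=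
          (measure_union_le _ _).trans (by gcongr; exact measure_union_le _ _)
      _ ≤ _ := add_le_add (add_le_add hPB₁ hPB₂) hPB₃
      _ ≤ _ := by
          rw [← ENNReal.ofReal_add (by positivity) (by positivity),
            ← ENNReal.ofReal_add (by positivity) (by positivity), add_assoc]
          refine ENNReal.ofReal_le_ofReal (add_le_add le_rfl ?_)
          rw [one_pow, mul_one]
          have h3 : (3 : ℝ) ≤ Real.exp (3 / 2) := by
            have := Real.quadratic_le_exp_of_nonneg (x := 3 / 2) (by norm_num)
            linarith
          calc Real.exp (-((DoF d fun k => 2 * r k : ℕ) : ℝ)) +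
                2 * Real.exp (-((DoF d fun k => 2 * r k : ℕ) : ℝ))
              = 3 * Real.exp (-((DoF d fun k => 2 * r k : ℕ) : ℝ)) := by ring
            _ ≤ Real.exp (3 / 2) * Real.exp (-(2 * (DoF d r : ℝ))) := by gcongr
            _ ≤ Real.exp (-(DoF d r : ℝ) / 2) := by
                rw [← Real.exp_add]
                apply Real.exp_le_exp.2
                linarith
  refine ⟨(toMeasurable P (B₁ ∪ B₂ ∪ B₃))ᶜ, (measurableSet_toMeasurable _ _).compl, ?_, ?_⟩
  · rw [probReal_compl_eq_one_sub (measurableSet_toMeasurable _ _), measureReal_def,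
      measure_toMeasurable]
    have h1 := ENNReal.toReal_le_of_le_ofReal (by positivity) hPB
    linarith
  intro ω hω
  have hωB : ω ∉ B₁ ∪ B₂ ∪ B₃ := fun h => hω (subset_toMeasurable _ _ h)
  rw [Set.mem_union, Set.mem_union, not_or, not_or] at hωB
  obtain ⟨⟨hω₁, hω₂⟩, hω₃⟩ := hωB
  have hslice : ∀ (k : Fin m) (j : Fin (d k)),
      ∑ I, |Ξ ((Equiv.piSplitAt k fun j => Fin (d j)).symm (j, I)) ω| ≤
        3 * dMinus d k * noiseScale ν ε := fun k j => by
    by_contra! hc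
    exact hω₁ ⟨k, j, hc⟩
  have htotal : ∑ i, |Ξ i ω| ≤ 3 * dStar d * noiseScale ν ε := by
    rw [sum_multiIndex_split ⟨0, hm⟩, dStar_eq_mul d ⟨0, hm⟩]
    refine (Finset.sum_le_sum fun j _ => hslice ⟨0, hm⟩ j).trans (le_of_eq ?_)
    simp only [Finset.sum_const, Finset.card_univ, Fintype.card_fin, nsmul_eq_mul]
    push_cast; ring
  have hG1 : ∀ T G : Tensor d, IsSubgradient (huberObj δ (observed Tstar Ξ ω)) T G →
      ∀ i, |G i| ≤ 1 := fun T G hG i => by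
    rw [hG.apply_eq hδ i]; exact abs_huberDeriv_le_one hδ _
  constructor
  · intro T
    refine ⟨fun G hG ρ 𝕋 _ => (Submodule.norm_starProjection_apply_le _ _).trans
      (norm_le_sqrt_dStar (hG1 T G hG)), huberObj_sub_ge hδ htotal T, fun ρ μ hT k => ⟨?_, ?_⟩⟩
    · exact fun G hG 𝕋 h𝕋 => hT.twoInfNorm_starProjection_le h𝕋 (hG1 T G hG) k
    · exact fun j => huberSlice_sub_ge hδ k j (hslice k j) T
  intro T hT hTmax hTfar
  have hTstar : Tstar ∈ tuckerRankLE d r := fun k => (hinc.1 k).le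
  have hsq := sqrt_DoF_two_mul_le hm d r
  have hA : (0 : ℝ) < 128 * (m + 1) * 2 ^ m := by positivity
  refine ⟨fun G hG 𝕋 h𝕋 => ?_, ?_⟩
  · -- the gradient at the true tensor, paired with a low-rank direction
    have hpair : ∀ H ∈ tuckerRankLE d r,
        |inner ℝ (WithLp.toLp 2 fun i => huberDeriv δ (-Ξ i ω) : Tensor d) H| ≤
          (128 * (m + 1) * 2 ^ m * Real.sqrt (DoF d r)) * ‖H‖ := by
      intro H hH
      rcases (norm_nonneg H).eq_or_lt with h0 | h0
      · rw [norm_eq_zero.1 h0.symm]; simp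
      by_contra! hc
      refine hω₂ ⟨‖H‖⁻¹ • H, tuckerRankLE_mono (fun k => by omega)
        (smul_mem_tuckerRankLE _ hH), ?_, ?_⟩
      · rw [norm_smul, norm_inv, norm_norm, inv_mul_cancel₀ h0.ne']
      · rw [hχdef, centeredSum_huberDeriv hnoise hδ hΞ hν, centeredSum_huberDeriv hnoise hδ hΞ hν,
          inner_zero_right, sub_zero, inner_smul_right, abs_mul, abs_inv, abs_norm,
          inv_mul_eq_div, lt_div_iff₀ h0]
        refine lt_of_le_of_lt ?_ hc
        refine mul_le_mul_of_nonneg_right ?_ h0.le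
        calc _ ≤ 64 * (1 * ((m : ℝ) + 1)) * (2 ^ m * Real.sqrt (DoF d r)) * 1 := by gcongr
          _ = 64 * (((m : ℝ) + 1) * 2 ^ m * Real.sqrt (DoF d r)) := by ring
          _ ≤ 128 * (((m : ℝ) + 1) * 2 ^ m * Real.sqrt (DoF d r)) := by gcongr; norm_num
          _ = _ := by ring
    have h1 := norm_starProjection_gradient_le hδ (by positivity) hG hpair h𝕋
    have h2 : (2 * m + 1) * (128 * (m + 1) * 2 ^ m * Real.sqrt (DoF d r)) ≤
        δ⁻¹ * ‖T - Tstar‖ := by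
      rw [inv_mul_eq_div, le_div_iff₀ hδ]
      refine le_trans ?_ hTfar
      calc (2 * m + 1) * (128 * (m + 1) * 2 ^ m * Real.sqrt (DoF d r)) * δ
          ≤ (4 * ((2 * m + 1) * (128 * (m + 1) * 2 ^ m * Real.sqrt (DoF d r)))) * b₀ := by
            have hx : 0 ≤ (2 * m + 1) * (128 * (m + 1) * 2 ^ m * Real.sqrt (DoF d r)) := by
              positivity
            exact mul_le_mul (by linarith) hbδ hδ.le (by positivity)
        _ = _ := by simp only [ρ₀, hc₁]; ring
    have h3 : (1 : ℝ) ≤ Real.sqrt ((m : ℝ) + 1) :=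
      Real.one_le_sqrt.2 (by linarith [Nat.cast_nonneg (α := ℝ) m])
    have h4 : 2 * δ⁻¹ * 1 * ‖T - Tstar‖ ≤
        2 * δ⁻¹ * Real.sqrt ((m : ℝ) + 1) * ‖T - Tstar‖ := by gcongr
    linarith
  · have h1 := huberObj_sub_ge_of_centeredSum (P := P) hnoise hδ hR hΞ hν Tstar T hTmax ω
    have h2 : |centeredSum P ψ Ξ (T - Tstar) ω - centeredSum P ψ Ξ 0 ω| ≤
        128 * (m + 1) * Real.sqrt (DoF d fun k => 2 * r k) * ‖T - Tstar‖ ^ 2 / ρ₀ := by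
      by_contra! hc
      exact hω₃ ⟨T - Tstar, sub_mem_tuckerRankLE hT hTstar, hTfar, hc⟩
    have h3 : centeredSum P ψ Ξ (0 : Tensor d) ω = 0 := by
      simp [centeredSum, hψ.zero]
    rw [h3, sub_zero] at h2
    have h4 : 128 * (m + 1) * Real.sqrt (DoF d fun k => 2 * r k) * ‖T - Tstar‖ ^ 2 / ρ₀ ≤
        ‖T - Tstar‖ ^ 2 / (4 * b₀) := by
      rw [div_le_div_iff₀ hρ₀ (by positivity)]
      calc 128 * (m + 1) * Real.sqrt (DoF d fun k => 2 * r k) * ‖T - Tstar‖ ^ 2 * (4 * b₀)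
          ≤ 128 * (m + 1) * (2 ^ m * Real.sqrt (DoF d r)) * ‖T - Tstar‖ ^ 2 * (4 * b₀) := by
            gcongr
        _ = ‖T - Tstar‖ ^ 2 * (4 * 1 * (128 * (m + 1) * 2 ^ m) * b₀ * Real.sqrt (DoF d r)) := by
            ring
        _ ≤ ‖T - Tstar‖ ^ 2 * ρ₀ := by
            simp only [ρ₀, hc₁]
            gcongr
            linarith [Nat.cast_nonneg (α := ℝ) m]
    have h5 := neg_le_of_abs_le h2
    have h6 : ‖T - Tstar‖ ^ 2 / (2 * b₀) = 2 * (‖T - Tstar‖ ^ 2 / (4 * b₀)) := by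
      field_simp; norm_num
    rw [inv_mul_eq_div]
    change ‖T - Tstar‖ ^ 2 / (4 * b₀) ≤ _
    linarith
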